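/- Let $\alpha\in(0,1)$ and $\beta\ge 0$. For a real random variable $\xi$ with distribution function $F$ put $\mathrm{VaR}_q(\xi)=\inf\{z: F(z)\ge q\}$ and $\mathrm{CVaR}_\alpha(\xi)=\frac1{1-\alpha}\int_\alpha^1\mathrm{VaR}_q(\xi)\,dq$. Consider a Markov decision process with finite nonempty state space $\mathcal S$, finite nonempty sets $\mathcal A(i)$ of admissible actions, $\mathcal K=\{(i,a): i\in\mathcal S, a\in\mathcal A(i)\}$, transition probabilities $P(j\mid i,a)$ and rewards $r:\mathcal K\to\mathbb R$ with minimum $L_r$ and maximum $U_r$. Assume that under every stationary randomized policy $d$ the Markov chain of states is unichain (exactly one recurrent class) and aperiodic (every recurrent state has period one). For a history-dependent randomized policy $u$ and an initial state $s$ let $R_t^{s,u}=r(s_t,a_t)$ and let $J^u_{\beta}(s)$ be the limit, whenever it exists, and $J^u_{\beta,+}(s)$, $J^u_{\beta,-}(s)$ the limsup and liminf, as $T\to\infty$, of $$\frac1T\sum_{t=0}^{T-1}\bigl[\mathrm{CVaR}_\alpha(R_t^{s,u})+\beta\,\mathbb E(R_t^{s,u})\bigr].$$ Call $u$ well defined if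 the limit exists for every $s$. Let $$\mathbb X=\Bigl\{x\in\mathbb R^{\mathcal K}: x\ge0,\ \sum_{(i,a)\in\mathcal K} x(i,a)=1,\ \sum_{a\in\mathcal A(j)}x(j,a)=\sum_{(i,a)\in\mathcal K}P(j\mid i,a)x(i,a)\ \forall j\in\mathcal S\Bigr\},\qquad \mathbb Y=[L_r,U_r],$$ $$v_\beta(x,y)=\sum_{(i,a)\in\mathcal K}x(i,a)\Bigl\{y+\frac1{1-\alpha}[r(i,a)-y]^++\beta r(i,a)\Bigr\}.$$ Then: 1. (Optimality and saddle value.) For every stationary randomized policy $d$, the long-run averages of $\mathrm{CVaR}_\alpha(R^{s,d}_t)$ and of $\mathbb E(R^{s,d}_t)$ converge to limits $\mathrm{CVaR}^d$ and $\eta^d$ that do not depend on $s$, so that $d$ is well defined with $J^d_\beta(s)=\mathrm{CVaR}^d+\beta\eta^d$. There is a number $V$ such that, for every $s$, $$\max_{u\ \text{well defined}}J^u_\beta(s)=\max_u J^u_{\beta,+}(s)=\max_uJ^u_{\beta,-}(s)=\max_{d\ \text{stationary}}J^d_\beta(s)=V=\max_{x\in\mathbb X}\min_{y\in\mathbb Y}v_\beta(x,y)=\min_{y\in\mathbb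 Y}\max_{x\in\mathbb X}v_\beta(x,y),$$ where $u$ ranges over history-dependent randomized policies. Saddle points of $v_\beta$ on $\mathbb X\times\mathbb Y$ exist and have value $V$. 2. (At most one randomization.) There is a stationary randomized policy $d^*$ that is optimal for all three criteria (limit, limsup, liminf) and all initial states simultaneously, and for which $\sum_{i\in\mathcal S}\bigl(\#\{a\in\mathcal A(i):d^*(a\mid i)>0\}-1\bigr)\le1$. 3. (Two linear programs.) Let $x^1,\dots,x^L$ be the vertices of $\mathbb X$ (there are finitely many). The linear programs $$\min_{y,z_1,w} z_1\ \text{ s.t. }\ \sum_{(i,a)}x^l(i,a)\Bigl[y+\frac{w(i,a)}{1-\alpha}+\beta r(i,a)\Bigr]\le z_1\ \forall l,\quad w(i,a)\ge r(i,a)-y,\ w(i,a)\ge0\ \forall(i,a),\quad L_r\le y\le U_r,$$ $$\max_{x,z_2} z_2\ \text{ s.t. }\ \sum_{(i,a)}x(i,a)\Bigl[r(i_0,a_0)+\frac{(r(i,a)-r(i_0,a_0))^+}{1-\alpha}+\beta r(i,a)\Bigr]\ge z_2\ \forall(i_0,a_0)\in\mathcal K,\quad x\in\mathbb X,$$ have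 optimal solutions. If $(y^*,z_1^*,w^*)$ and $(x^*,z_2^*)$ are any optimal solutions of them, then $(x^*,y^*)$ is a saddle point of $v_\beta$, $z_1^*=z_2^*=V$, and every stationary policy $d^*$ with $d^*(a\mid i)=x^*(i,a)/\sum_{a'}x^*(i,a')$ whenever $\sum_{a'}x^*(i,a')>0$ (and arbitrary $d^*(\cdot\mid i)$ otherwise) is optimal for all three criteria; such policies exist. 4. (Determinism does not suffice.) For every $\alpha\in(0,1)$ and $\beta\ge0$ there is a Markov decision process as above for which no stationary deterministic policy is optimal for any of the three criteria. -/

import Mathlib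

open MeasureTheory Filter Topology

noncomputable section

namespace MeanCVaR

/-- The value-at-risk (`q`-quantile) of a real random variable with law `μ`:
`inf {z : F(z) ≥ q}` with `F` the distribution function. -/
def VaR (μ : Measure ℝ) (q : ℝ) : ℝ :=
  sInf {z : ℝ | q ≤ μ.real (Set.Iic z)}

/-- The right-tailed conditional value-at-risk at level `α` of a law `μ`. -/
def CVaR (α : ℝ) (μ : Measure ℝ) : ℝ :=
  (1 / (1 - α)) * ∫ q in α..1, VaR μ q

/-- `C` is a closed irreducible class (recurrent class) of the transition matrix `Q`. -/
def IsRecurrentClass {S : Type*} [Fintype S] [DecidableEq S]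
    (Q : Matrix S S ℝ) (C : Set S) : Prop :=
  C.Nonempty ∧ (∀ i ∈ C, ∀ j, j ∉ C → Q i j = 0) ∧
    ∀ i ∈ C, ∀ j ∈ C, ∃ n : ℕ, 0 < (Q ^ n) i j

/-- There is exactly one recurrent class (all other states are transient). -/
def IsUnichain {S : Type*} [Fintype S] [DecidableEq S] (Q : Matrix S S ℝ) : Prop :=
  ∃! C : Set S, IsRecurrentClass Q C

/-- Every recurrent state has period one: `1` is the only common divisor of its return times. -/
def IsAperiodic {S : Type*} [Fintype S] [DecidableEq S] (Q : Matrix S S ℝ) : Prop :=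
  ∀ C : Set S, IsRecurrentClass Q C → ∀ i ∈ C,
    ∀ p : ℕ, (∀ n : ℕ, 1 ≤ n → 0 < (Q ^ n) i i → p ∣ n) → p = 1

/-- A Markov decision process with state space `S` and admissible actions `A i` in state `i`
(finiteness of `S` and of all `A i` is required where it is used). -/
structure MDP (S : Type*) (A : S → Type*) where
  /-- `P i a` is the law of the next state when `a` is chosen in state `i`. -/
  P : (i : S) → A i → PMF S
  /-- The reward function. -/
  r : (i : S) → A i → ℝ

/-- State-action pairs. -/
abbrev Pairs (S : Type*) (A : S → Type*) : Type _ := Σ i : S, A i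

/-- History-dependent randomized policies: `u t h i` is the law of the action at time `t` when the
past state-action pairs are `h` and the current state is `i`. -/
abbrev Policy (S : Type*) (A : S → Type*) : Type _ :=
  (t : ℕ) → (Fin t → Pairs S A) → (i : S) → PMF (A i)

/-- Stationary randomized policies. -/
abbrev Stationary (S : Type*) (A : S → Type*) : Type _ := (i : S) → PMF (A i)

/-- A stationary randomized policy as a history-dependent policy. -/
def Stationary.toPolicy {S : Type*} {A : S → Type*} (d : Stationary S A) : Policy S A :=
  fun _ _ i => d i

/-- The stationary deterministic policy choosing action `f i` in state `i`. -/
def deterministic {S : Type*} {A : S → Type*} (f : (i : S) → A i) : Stationary S A :=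
  fun i => PMF.pure (f i)

/-- The number of randomizations of `d`: the sum over the states of the number of actions that have
positive probability, minus one (at least one action has positive probability). -/
def Stationary.numRandomizations {S : Type*} {A : S → Type*} [Fintype S]
    (d : Stationary S A) : ℕ :=
  ∑ i : S, (Set.ncard {a : A i | 0 < d i a} - 1)

namespace MDP

variable {S : Type*} {A : S → Type*}

/-- The law of the history `(s₀, a₀, …, s_{t-1}, a_{t-1}, s_t)` under policy `u` and initial
state `s`, i.e. the finite-dimensional law of the trajectory measure `ℙ_s^u`. -/
def historyLaw (M : MDP S A) (u : Policy S A) (s : S) :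
    (t : ℕ) → PMF ((Fin t → Pairs S A) × S)
  | 0 => PMF.pure (fun k => k.elim0, s)
  | t + 1 =>
      (M.historyLaw u s t).bind fun h =>
        (u t h.1 h.2).bind fun a =>
          (M.P h.2 a).map fun j => (Fin.snoc (α := fun _ => Pairs S A) h.1 ⟨h.2, a⟩, j)

/-- The law of the state-action pair `(s_t, a_t)`. -/
def pairLaw (M : MDP S A) (u : Policy S A) (s : S) (t : ℕ) : PMF (Pairs S A) :=
  (M.historyLaw u s t).bind fun h => (u t h.1 h.2).map fun a => ⟨h.2, a⟩

/-- The law of the instantaneous reward `R_t = r(s_t, a_t)`. -/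
def rewardLaw (M : MDP S A) (u : Policy S A) (s : S) (t : ℕ) : Measure ℝ :=
  ((M.pairLaw u s t).map fun k => M.r k.1 k.2).toMeasure

/-- Average CVaR of the first `T` rewards. -/
def cvarAvg (M : MDP S A) (α : ℝ) (u : Policy S A) (s : S) (T : ℕ) : ℝ :=
  (1 / (T : ℝ)) * ∑ t ∈ Finset.range T, CVaR α (M.rewardLaw u s t)

/-- Average expected reward over the first `T` periods. -/
def meanAvg (M : MDP S A) (u : Policy S A) (s : S) (T : ℕ) : ℝ :=
  (1 / (T : ℝ)) * ∑ t ∈ Finset.range T, ∫ x, x ∂(M.rewardLaw u s t)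

/-- The combined mean-CVaR average over the first `T` periods. -/
def combAvg (M : MDP S A) (α β : ℝ) (u : Policy S A) (s : S) (T : ℕ) : ℝ :=
  (1 / (T : ℝ)) * ∑ t ∈ Finset.range T,
    (CVaR α (M.rewardLaw u s t) + β * ∫ x, x ∂(M.rewardLaw u s t))

/-- The limsup version of the long-run mean-CVaR criterion. -/
def Jsup (M : MDP S A) (α β : ℝ) (u : Policy S A) (s : S) : ℝ :=
  limsup (M.combAvg α β u s) atTop

/-- The liminf version of the long-run mean-CVaR criterion. -/
def Jinf (M : MDP S A) (α β : ℝ) (u : Policy S A) (s : S) : ℝ :=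
  liminf (M.combAvg α β u s) atTop

/-- The long-run mean-CVaR criterion of `u` is well defined: the limit exists for every
initial state. -/
def WellDefined (M : MDP S A) (α β : ℝ) (u : Policy S A) : Prop :=
  ∀ s : S, ∃ l : ℝ, Tendsto (M.combAvg α β u s) atTop (𝓝 l)

/-- The long-run mean-CVaR criterion (meaningful for policies for which it is well defined). -/
def J (M : MDP S A) (α β : ℝ) (u : Policy S A) (s : S) : ℝ :=
  limUnder atTop (M.combAvg α β u s)

/-- `u` is well defined and optimal among all well defined policies, for every initial state. -/
def IsOptimal (M : MDP S A) (α β : ℝ) (u : Policy S A) : Prop :=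
  M.WellDefined α β u ∧ ∀ u', M.WellDefined α β u' → ∀ s, M.J α β u' s ≤ M.J α β u s

/-- `u` maximizes the limsup criterion over all policies, for every initial state. -/
def IsSupOptimal (M : MDP S A) (α β : ℝ) (u : Policy S A) : Prop :=
  ∀ u' s, M.Jsup α β u' s ≤ M.Jsup α β u s

/-- `u` maximizes the liminf criterion over all policies, for every initial state. -/
def IsInfOptimal (M : MDP S A) (α β : ℝ) (u : Policy S A) : Prop :=
  ∀ u' s, M.Jinf α β u' s ≤ M.Jinf α β u s

/-- The one-step transition matrix of the state process under the stationary policy `d`. -/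
def transition (M : MDP S A) (d : Stationary S A) : Matrix S S ℝ :=
  fun i j => ((d i).bind (M.P i) j).toReal

/-- For each stationary randomized policy the Markov chain is unichain and aperiodic. -/
def UnichainAperiodic [Fintype S] [DecidableEq S] (M : MDP S A) : Prop :=
  ∀ d : Stationary S A, IsUnichain (M.transition d) ∧ IsAperiodic (M.transition d)

variable [Fintype S] [∀ i, Fintype (A i)]

/-- The polytope `𝕏` of feasible steady-state distributions. -/
def X (M : MDP S A) : Set (Pairs S A → ℝ) :=
  {x | (∀ j : S, ∑ a : A j, x ⟨j, a⟩ = ∑ k : Pairs S A, (M.P k.1 k.2 j).toReal * x k) ∧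
    ∑ k : Pairs S A, x k = 1 ∧ ∀ k, 0 ≤ x k}

/-- The interval `𝕐 = [L_r, U_r]` between the smallest and the largest reward. -/
def Y (M : MDP S A) : Set ℝ :=
  Set.Icc (⨅ k : Pairs S A, M.r k.1 k.2) (⨆ k : Pairs S A, M.r k.1 k.2)

/-- The saddle function `∑ x(i,a) {y + [r(i,a) - y]⁺ / (1 - α) + β r(i,a)}`. -/
def saddleFun (M : MDP S A) (α β : ℝ) (x : Pairs S A → ℝ) (y : ℝ) : ℝ :=
  ∑ k : Pairs S A,
    x k * (y + (1 / (1 - α)) * max (M.r k.1 k.2 - y) 0 + β * M.r k.1 k.2)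

/-- `(x, y)` is a saddle point of the saddle function on `𝕏 × 𝕐`. -/
def IsSaddle (M : MDP S A) (α β : ℝ) (x : Pairs S A → ℝ) (y : ℝ) : Prop :=
  x ∈ M.X ∧ y ∈ M.Y ∧
    (∀ x' ∈ M.X, M.saddleFun α β x' y ≤ M.saddleFun α β x y) ∧
    ∀ y' ∈ M.Y, M.saddleFun α β x y ≤ M.saddleFun α β x y'

/-- `V = max_{x ∈ 𝕏} min_{y ∈ 𝕐} v(x,y)`, all minima and the maximum being attained. -/
def IsMaxMin (M : MDP S A) (α β V : ℝ) : Prop :=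
  (∀ x ∈ M.X, ∃ m, IsLeast (M.saddleFun α β x '' M.Y) m) ∧
    IsGreatest {m | ∃ x ∈ M.X, IsLeast (M.saddleFun α β x '' M.Y) m} V

/-- `V = min_{y ∈ 𝕐} max_{x ∈ 𝕏} v(x,y)`, all maxima and the minimum being attained. -/
def IsMinMax (M : MDP S A) (α β V : ℝ) : Prop :=
  (∀ y ∈ M.Y, ∃ m, IsGreatest ((fun x => M.saddleFun α β x y) '' M.X) m) ∧
    IsLeast {m | ∃ y ∈ M.Y, IsGreatest ((fun x => M.saddleFun α β x y) '' M.X) m} V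

/-- Feasibility of `(y, z, w)` for the primal program (minimize `z`); the first group of
constraints runs over the vertices of `𝕏`. -/
def PrimalFeasible (M : MDP S A) (α β : ℝ) (y z : ℝ) (w : Pairs S A → ℝ) : Prop :=
  (∀ x ∈ Set.extremePoints ℝ M.X,
      ∑ k : Pairs S A, x k * (y + (1 / (1 - α)) * w k + β * M.r k.1 k.2) ≤ z) ∧
    (∀ k : Pairs S A, M.r k.1 k.2 - y ≤ w k) ∧ (∀ k, 0 ≤ w k) ∧
    (⨅ k : Pairs S A, M.r k.1 k.2) ≤ y ∧ y ≤ ⨆ k : Pairs S A, M.r k.1 k.2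

/-- `(y, z, w)` is an optimal solution of the primal program. -/
def PrimalOptimal (M : MDP S A) (α β : ℝ) (y z : ℝ) (w : Pairs S A → ℝ) : Prop :=
  M.PrimalFeasible α β y z w ∧ ∀ y' z' w', M.PrimalFeasible α β y' z' w' → z ≤ z'

/-- Feasibility of `(x, z)` for the dual program (maximize `z`). -/
def DualFeasible (M : MDP S A) (α β : ℝ) (x : Pairs S A → ℝ) (z : ℝ) : Prop :=
  (∀ l : Pairs S A, z ≤ ∑ k : Pairs S A, x k * (M.r l.1 l.2 +
      (1 / (1 - α)) * max (M.r k.1 k.2 - M.r l.1 l.2) 0 + β * M.r k.1 k.2)) ∧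
    (∀ j : S, ∑ a : A j, x ⟨j, a⟩ - ∑ k : Pairs S A, (M.P k.1 k.2 j).toReal * x k = 0) ∧
    ∑ k : Pairs S A, x k = 1 ∧ ∀ k, 0 ≤ x k

/-- `(x, z)` is an optimal solution of the dual program. -/
def DualOptimal (M : MDP S A) (α β : ℝ) (x : Pairs S A → ℝ) (z : ℝ) : Prop :=
  M.DualFeasible α β x z ∧ ∀ x' z', M.DualFeasible α β x' z' → z' ≤ z

end MDP

/-- `d` is a stationary policy read off from `x`: `d(a|i) = x(i,a) / ∑_{a'} x(i,a')` whenever the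
denominator is positive, and `d(·|i)` is arbitrary otherwise. -/
def ReadOff {S : Type*} {A : S → Type*} [∀ i, Fintype (A i)]
    (x : Pairs S A → ℝ) (d : Stationary S A) : Prop :=
  ∀ i : S, 0 < ∑ a' : A i, x ⟨i, a'⟩ →
    ∀ a : A i, (d i a).toReal = x ⟨i, a⟩ / ∑ a' : A i, x ⟨i, a'⟩

end MeanCVaR

end

/-! By the Rockafellar–Uryasev formula, `CVaR α μ` is the minimum over `y` of `y + E[(ξ - y)⁺] / (1
- α)`, attained at the value-at-risk (`CVaR_le`, `CVaR_eq`). Hence the mean-CVaR of the reward at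
time `t` equals `value`, the minimum over `𝕐` of the saddle function at the law of the state-action
pair (`comb_eq_value`). The saddle function is linear in the measure `x` and convex in `y`.

Upper bound. Fix `y` in `𝕐`. The average criterion is at most the saddle function at the empirical
frequencies and `y`. The balance defects of these frequencies telescope to `O(1/T)`, whatever the
policy, so every cluster point lies in `𝕏`. Thus the limsup of any policy is at most the maximum
over `𝕏` of the saddle function at `y` (`Jsup_le`).

Lower bound. A policy read off from `x ∈ 𝕏` has `x` as its steady state. Doeblin's contraction gives
convergence of the pair laws to `x`, and continuity of `value` gives the limit `value x`
(`tendsto_pairProb_of_readOff`, `tendsto_combAvg`). Sion's theorem supplies a saddle point, at which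
the two bounds meet.

One randomization. At a saddle point `(x₀, y)`, minimality in `y` is secured by one linear equation
in `x`, namely that a fixed subgradient has mean `1 - α`. An extreme point of the maximizers in `𝕏`
satisfying this equation charges at most one pair more than it charges states
(`exists_isSaddle_card_le`).

Linear programs. A linear function on `𝕏` is bounded by its values at the vertices, and the saddle
function is affine in `y` between consecutive rewards. The two programs therefore express the
min-max and the max-min problem.

Determinism. In a two-state lottery, mixing a safe reward with a slightly unfavourable gamble places
exactly mass `1 - α` on the positive rewards and beats both pure choices. -/

namespace MeanCVaR

/-! ### Quantiles and the Rockafellar–Uryasev formula. -/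

section Quantile

variable (μ : Measure ℝ) [IsProbabilityMeasure μ]

/-- Right continuity of the distribution function; it makes the infimum defining `VaR` a minimum. -/
theorem isClosed_VaR_set (q : ℝ) : IsClosed {z : ℝ | q ≤ μ.real (Set.Iic z)} := by
  have : {z : ℝ | q ≤ μ.real (Set.Iic z)} = {z : ℝ | q ≤ ProbabilityTheory.cdf μ z} := by
    ext z; simp [ProbabilityTheory.cdf_eq_real]
  rw [this]
  set f := ProbabilityTheory.cdf μ
  rw [← isOpen_compl_iff, isOpen_iff_mem_nhds]
  intro z hz
  simp only [Set.mem_compl_iff, Set.mem_ofPred_eq, not_le] at hz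
  have hr : ContinuousWithinAt f (Set.Ici z) z := f.right_continuous z
  have h1 : ∀ᶠ w in 𝓝[≥] z, f w < q := hr.eventually_lt_const hz
  have h2 : ∀ᶠ w in 𝓝[≤] z, f w < q := by
    filter_upwards [self_mem_nhdsWithin] with w hw
    exact (f.mono hw).trans_lt hz
  have h3 : ∀ᶠ w in 𝓝 z, f w < q := by
    rw [← nhdsLE_sup_nhdsGE]
    exact eventually_sup.2 ⟨h2, h1⟩
  filter_upwards [h3] with w hw
  simpa using hw

theorem nonempty_VaR_set {q : ℝ} (hq : q < 1) : {z : ℝ | q ≤ μ.real (Set.Iic z)}.Nonempty := by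
  have h := (ProbabilityTheory.tendsto_cdf_atTop μ).eventually (eventually_gt_nhds hq)
  obtain ⟨z, hz⟩ := h.exists
  exact ⟨z, by simpa [ProbabilityTheory.cdf_eq_real] using hz.le⟩

theorem bddBelow_VaR_set {q : ℝ} (hq : 0 < q) : BddBelow {z : ℝ | q ≤ μ.real (Set.Iic z)} := by
  have h := (ProbabilityTheory.tendsto_cdf_atBot μ).eventually (eventually_lt_nhds hq)
  obtain ⟨z, hz⟩ := h.exists
  refine ⟨z, fun w hw => ?_⟩
  by_contra hlt
  have := (ProbabilityTheory.monotone_cdf μ) (not_le.1 hlt).le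
  simp only [ProbabilityTheory.cdf_eq_real, Set.mem_ofPred_eq] at *
  linarith

/-- The Galois connection through which all later properties of `VaR` are derived. At `q = 0` the
defining set is all of `ℝ` and at `q = 1` it may be empty, so `sInf` may return its default value
there; hence the open interval. -/
theorem VaR_le_iff {q : ℝ} (hq : q ∈ Set.Ioo (0 : ℝ) 1) (z : ℝ) :
    VaR μ q ≤ z ↔ q ≤ μ.real (Set.Iic z) := by
  refine ⟨fun h => ?_, fun h => csInf_le (bddBelow_VaR_set μ hq.1) h⟩
  have hm := (isClosed_VaR_set μ q).csInf_mem (nonempty_VaR_set μ hq.2) (bddBelow_VaR_set μ hq.1)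
  exact le_trans hm (measureReal_mono (Set.Iic_subset_Iic.2 h))

theorem monotoneOn_VaR : MonotoneOn (VaR μ) (Set.Ioo 0 1) := fun q hq q' hq' h => by
  rw [VaR_le_iff μ hq]
  exact h.trans ((VaR_le_iff μ hq' _).1 le_rfl)

theorem aemeasurable_VaR : AEMeasurable (VaR μ) (volume.restrict (Set.Ioo 0 1)) :=
  aemeasurable_restrict_of_monotoneOn measurableSet_Ioo (monotoneOn_VaR μ)

/-- The quantile transform: under the uniform law on `(0, 1)` the quantile function has law `μ`. -/
theorem map_VaR : (volume.restrict (Set.Ioo (0 : ℝ) 1)).map (VaR μ) = μ := by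
  have : IsFiniteMeasure (volume.restrict (Set.Ioo (0 : ℝ) 1)) := ⟨by simp⟩
  refine Measure.ext_of_Iic _ _ fun z => ?_
  rw [Measure.map_apply_of_aemeasurable (aemeasurable_VaR μ) measurableSet_Iic,
    Measure.restrict_apply' measurableSet_Ioo]
  have h1 : VaR μ ⁻¹' Set.Iic z ∩ Set.Ioo 0 1 = Set.Ioc 0 (μ.real (Set.Iic z)) ∩ Set.Ioo 0 1 := by
    ext q
    simp only [Set.mem_inter_iff, Set.mem_preimage, Set.mem_Iic, Set.mem_Ioc]
    constructor
    · rintro ⟨h, hq⟩; exact ⟨⟨hq.1, (VaR_le_iff μ hq z).1 h⟩, hq⟩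
    · rintro ⟨h, hq⟩; exact ⟨(VaR_le_iff μ hq z).2 h.2, hq⟩
  have h2 : μ.real (Set.Iic z) ≤ 1 := measureReal_le_one
  have h3 : (Set.Ioc 0 (μ.real (Set.Iic z)) ∩ Set.Ioo 0 1 : Set ℝ) =ᵐ[volume]
      Set.Ioc 0 (μ.real (Set.Iic z)) := by
    have h4 : (Set.Ioc 0 (μ.real (Set.Iic z)) ∩ Set.Ioo 0 1 : Set ℝ) =ᵐ[volume]
        (Set.Ioc 0 (μ.real (Set.Iic z)) ∩ Set.Ioc 0 1 : Set ℝ) :=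
      (ae_eq_refl _).inter Ioo_ae_eq_Ioc
    rwa [Set.inter_eq_left.2 (Set.Ioc_subset_Ioc_right h2)] at h4
  rw [h1, measure_congr h3, Real.volume_Ioc, sub_zero, ofReal_measureReal]

theorem integral_comp_VaR (f : ℝ → ℝ) (hf : AEStronglyMeasurable f μ) :
    ∫ q in Set.Ioo (0 : ℝ) 1, f (VaR μ q) = ∫ x, f x ∂μ := by
  have h := integral_map (aemeasurable_VaR μ) (f := f) (by rwa [map_VaR])
  rw [map_VaR] at h
  exact h.symm

theorem integrable_comp_VaR (f : ℝ → ℝ) (hf : Integrable f μ) :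
    IntegrableOn (fun q => f (VaR μ q)) (Set.Ioo (0 : ℝ) 1) := by
  have h := integrable_map_measure (f := VaR μ) (μ := volume.restrict (Set.Ioo (0 : ℝ) 1)) (g := f)
    (by rw [map_VaR]; exact hf.1) (aemeasurable_VaR μ)
  rw [map_VaR] at h
  exact h.1 hf

variable {μ} {α : ℝ} (hα : α ∈ Set.Ioo (0 : ℝ) 1)
include hα

/-- Places the Rockafellar–Uryasev minimizer in `𝕐`, so that minimizing over a compact interval
loses nothing. -/
theorem VaR_mem_Icc {a b : ℝ} (hab : ∀ᵐ x ∂μ, x ∈ Set.Icc a b) : VaR μ α ∈ Set.Icc a b := by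
  constructor
  · by_contra h
    have h1 := (VaR_le_iff μ hα (VaR μ α)).1 le_rfl
    have h2 : μ (Set.Iic (VaR μ α)) = 0 := by
      rw [measure_eq_zero_iff_ae_notMem]
      filter_upwards [hab] with x hx hx'
      exact h (hx.1.trans hx')
    rw [measureReal_def, h2] at h1
    exact absurd hα.1 (not_lt.2 (by simpa using h1))
  · rw [VaR_le_iff μ hα]
    have h2 : μ (Set.Iic b) = 1 := by
      rw [prob_compl_eq_zero_iff measurableSet_Iic |>.symm, measure_eq_zero_iff_ae_notMem]
      filter_upwards [hab] with x hx hx'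
      exact hx' hx.2
    rw [measureReal_def, h2]
    simpa using hα.2.le

variable (hμ : Integrable (fun x => x) μ)
include hμ

/-- Writes `CVaR α μ - y` as a tail integral of `VaR μ q - y`; the formula then reduces to comparing
this integrand with its positive part. -/
theorem integral_VaR_sub (y : ℝ) :
    ∫ q in Set.Ioo α 1, (VaR μ q - y) = (1 - α) * (CVaR α μ - y) := by
  have h1 : IntegrableOn (VaR μ) (Set.Ioo α 1) :=
    (integrable_comp_VaR μ _ hμ).mono_set (Set.Ioo_subset_Ioo_left hα.1.le)
  have h2 : (1 : ℝ) - α ≠ 0 := by linarith [hα.2]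
  rw [integral_sub h1 (integrable_const _), CVaR, intervalIntegral.integral_of_le hα.2.le,
    integral_Ioc_eq_integral_Ioo]
  simp only [MeasureTheory.integral_const, MeasurableSet.univ, measureReal_restrict_apply,
    Set.univ_inter, Real.volume_real_Ioo_of_le hα.2.le, smul_eq_mul]
  field_simp

/-- The Rockafellar–Uryasev bound. -/
theorem CVaR_le (y : ℝ) :
    CVaR α μ ≤ y + (1 / (1 - α)) * ∫ x, max (x - y) 0 ∂μ := by
  have h0 : 0 < 1 - α := by linarith [hα.2]
  have hi : Integrable (fun x => max (x - y) 0) μ := (hμ.sub (integrable_const y)).pos_part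
  have h1 := integral_VaR_sub hα hμ y
  have hsub : Set.Ioo α 1 ⊆ Set.Ioo 0 1 := Set.Ioo_subset_Ioo_left hα.1.le
  have hi2 := integrable_comp_VaR μ _ hi
  have h2 : ∫ q in Set.Ioo α 1, (VaR μ q - y) ≤ ∫ q in Set.Ioo α 1, max (VaR μ q - y) 0 :=
    integral_mono (((integrable_comp_VaR μ _ hμ).mono_set hsub).sub (integrable_const _))
      (hi2.mono_set hsub) fun q => le_max_left _ _
  have h3 : ∫ q in Set.Ioo α 1, max (VaR μ q - y) 0 ≤ ∫ q in Set.Ioo 0 1, max (VaR μ q - y) 0 :=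
    setIntegral_mono_set hi2 (ae_of_all _ fun q => le_max_right _ _) hsub.eventuallyLE
  rw [integral_comp_VaR μ (fun x => max (x - y) 0) hi.1] at h3
  have h4 : CVaR α μ - y ≤ (1 / (1 - α)) * ∫ x, max (x - y) 0 ∂μ := by
    rw [one_div, ← div_eq_inv_mul, le_div_iff₀ h0]
    linarith
  linarith

/-- The Rockafellar–Uryasev bound is attained at the value-at-risk. -/
theorem CVaR_eq :
    CVaR α μ = VaR μ α + (1 / (1 - α)) * ∫ x, max (x - VaR μ α) 0 ∂μ := by
  have h0 : 0 < 1 - α := by linarith [hα.2]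
  set y := VaR μ α
  have hi : Integrable (fun x => max (x - y) 0) μ := (hμ.sub (integrable_const y)).pos_part
  have h1 := integral_VaR_sub hα hμ y
  have hsub : Set.Ioo α 1 ⊆ Set.Ioo 0 1 := Set.Ioo_subset_Ioo_left hα.1.le
  -- By monotonicity the quantile is at least `y` to the right of `α` and at most `y` to the left,
  -- so both inequalities of the bound become equalities.
  have h2 : ∫ q in Set.Ioo α 1, (VaR μ q - y) = ∫ q in Set.Ioo α 1, max (VaR μ q - y) 0 := by
    refine setIntegral_congr_fun measurableSet_Ioo fun q hq => ?_
    exact (max_eq_left (sub_nonneg.2 (monotoneOn_VaR μ hα (hsub hq) hq.1.le))).symm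
  have h3 : ∫ q in Set.Ioo α 1, max (VaR μ q - y) 0 = ∫ q in Set.Ioo 0 1, max (VaR μ q - y) 0 := by
    refine (setIntegral_eq_of_subset_of_forall_sdiff_eq_zero measurableSet_Ioo hsub
      fun q hq => ?_).symm
    have hqα : q ≤ α := by
      by_contra h
      exact hq.2 ⟨not_le.1 h, hq.1.2⟩
    exact max_eq_right (sub_nonpos.2 (monotoneOn_VaR μ hq.1 hα hqα))
  rw [integral_comp_VaR μ (fun x => max (x - y) 0) hi.1] at h3
  have h4 : CVaR α μ - y = (1 / (1 - α)) * ∫ x, max (x - y) 0 ∂μ := by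
    rw [one_div, ← div_eq_inv_mul, eq_div_iff h0.ne']
    linarith
  linarith

end Quantile

/-! ### Convergence of finite unichain aperiodic Markov chains. -/

section MarkovChain

variable {S : Type*} [Fintype S] [DecidableEq S] {Q : Matrix S S ℝ}

theorem pow_add_pos (hQ : Q ∈ Matrix.rowStochastic ℝ S) {m n : ℕ} {i k j : S}
    (h1 : 0 < (Q ^ m) i k) (h2 : 0 < (Q ^ n) k j) : 0 < (Q ^ (m + n)) i j := by
  rw [pow_add, Matrix.mul_apply]
  refine (mul_pos h1 h2).trans_le (Finset.single_le_sum
    (f := fun l => (Q ^ m) i l * (Q ^ n) l j) (fun l _ => ?_) (Finset.mem_univ k))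
  exact mul_nonneg ((pow_mem hQ m).1 _ _) ((pow_mem hQ n).1 _ _)

/-- The states that can be reached from `i`. -/
def reach (Q : Matrix S S ℝ) (i : S) : Set S := {j | ∃ n : ℕ, 0 < (Q ^ n) i j}

theorem reach_subset (hQ : Q ∈ Matrix.rowStochastic ℝ S) {i k : S} (h : k ∈ reach Q i) :
    reach Q k ⊆ reach Q i := by
  obtain ⟨m, hm⟩ := h
  rintro j ⟨n, hn⟩
  exact ⟨m + n, pow_add_pos hQ hm hn⟩

theorem self_mem_reach (i : S) : i ∈ reach Q i := ⟨0, by simp⟩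

/-- A recurrent class can be reached from every state. -/
theorem exists_recurrentClass_reach (hQ : Q ∈ Matrix.rowStochastic ℝ S) (i : S) :
    ∃ k ∈ reach Q i, IsRecurrentClass Q (reach Q k) := by
  -- Among the states reachable from `i`, take one with the fewest reachable states; by minimality
  -- every state reached from it reaches the same set.
  obtain ⟨k, hk, hmin⟩ := Set.exists_min_image (reach Q i) (fun k => (reach Q k).ncard)
    (Set.toFinite _) ⟨i, self_mem_reach i⟩
  refine ⟨k, hk, ⟨k, self_mem_reach k⟩, fun l hl j hj => ?_, fun l hl j hj => ?_⟩
  · by_contra h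
    refine hj (reach_subset hQ hl ⟨1, ?_⟩)
    rw [pow_one]
    exact lt_of_le_of_ne (hQ.1 _ _) (Ne.symm h)
  · have hsub := reach_subset hQ hl
    have heq : reach Q l = reach Q k :=
      Set.eq_of_subset_of_ncard_le hsub (hmin l (reach_subset hQ hk hl)) (Set.toFinite _)
    rw [← heq] at hj
    exact hj

/-- In a unichain aperiodic chain some state is reached from everywhere at a common time. -/
theorem exists_pow_pos (hQ : Q ∈ Matrix.rowStochastic ℝ S) (hU : IsUnichain Q)
    (hA : IsAperiodic Q) : ∃ N > 0, ∃ j : S, ∀ i, 0 < (Q ^ N) i j := by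
  obtain ⟨C, hC, huniq⟩ := hU
  obtain ⟨j, hj⟩ := hC.1
  have hreach : ∀ i, ∃ n, 0 < (Q ^ n) i j := by
    intro i
    obtain ⟨k, hk, hrec⟩ := exists_recurrentClass_reach hQ i
    rw [← huniq _ hrec] at hj
    exact reach_subset hQ hk hj
  -- The possible return times to `j` form an additive monoid of gcd 1, so they contain all large
  -- integers.
  let s : AddSubmonoid ℕ :=
    { carrier := {n | 0 < (Q ^ n) j j}
      zero_mem' := by simp
      add_mem' := fun h1 h2 => pow_add_pos hQ h1 h2 }
  have hgcd : Nat.setGcd (s : Set ℕ) = 1 :=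
    hA C hC j hj _ fun n _ hn => Nat.setGcd_dvd_of_mem hn
  obtain ⟨n₀, hn₀⟩ := Nat.exists_mem_closure_of_ge (s : Set ℕ)
  have hlarge : ∀ m ≥ n₀, 0 < (Q ^ m) j j := by
    intro m hm
    have := hn₀ m hm (by rw [hgcd]; exact one_dvd m)
    rw [AddSubmonoid.closure_eq] at this
    exact this
  choose n hn using hreach
  -- This time exceeds each hitting time `n i` by at least `n₀`; the surplus is spent on a return
  -- loop at `j`.
  refine ⟨n₀ + 1 + ∑ i, n i, by omega, j, fun i => ?_⟩
  have hle : n i ≤ ∑ i, n i := Finset.single_le_sum (fun _ _ => Nat.zero_le _) (Finset.mem_univ i)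
  have := pow_add_pos hQ (hn i) (hlarge (n₀ + 1 + ∑ i, n i - n i) (by omega))
  rwa [show n i + (n₀ + 1 + ∑ i, n i - n i) = n₀ + 1 + ∑ i, n i by omega] at this

theorem sum_vecMul (hQ : Q ∈ Matrix.rowStochastic ℝ S) (z : S → ℝ) :
    ∑ j, Matrix.vecMul z Q j = ∑ i, z i := by
  simp only [Matrix.vecMul, dotProduct]
  rw [Finset.sum_comm]
  simp [← Finset.mul_sum, Matrix.sum_row_of_mem_rowStochastic hQ]

/-- Doeblin's contraction estimate in the `ℓ¹` norm. -/
theorem sum_abs_vecMul_le (hQ : Q ∈ Matrix.rowStochastic ℝ S) {ε : ℝ} {j₀ : S}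
    (hε : ∀ i, ε ≤ Q i j₀) {z : S → ℝ} (hz : ∑ i, z i = 0) :
    ∑ j, |Matrix.vecMul z Q j| ≤ (1 - ε) * ∑ i, |z i| := by
  -- Subtracting `ε` from column `j₀` leaves a nonnegative matrix with row sums `1 - ε`, and does
  -- not change the image of a vector of total mass zero.
  have hnn : ∀ i j, 0 ≤ Q i j - if j = j₀ then ε else 0 := by
    intro i j
    split_ifs with h
    · rw [h]; linarith [hε i]
    · rw [sub_zero]; exact hQ.1 i j
  have heq : ∀ j, Matrix.vecMul z Q j = ∑ i, z i * (Q i j - if j = j₀ then ε else 0) := by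
    intro j
    simp only [mul_sub, Finset.sum_sub_distrib, ← Finset.sum_mul, hz, zero_mul, sub_zero]
    rfl
  calc ∑ j, |Matrix.vecMul z Q j|
      ≤ ∑ j, ∑ i, |z i| * (Q i j - if j = j₀ then ε else 0) := by
        refine Finset.sum_le_sum fun j _ => ?_
        rw [heq]
        refine (Finset.abs_sum_le_sum_abs _ _).trans (Finset.sum_le_sum fun i _ => ?_)
        rw [abs_mul, abs_of_nonneg (hnn i j)]
    _ = ∑ i, |z i| * (1 - ε) := by
        rw [Finset.sum_comm]
        refine Finset.sum_congr rfl fun i _ => ?_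
        rw [← Finset.mul_sum, Finset.sum_sub_distrib, Matrix.sum_row_of_mem_rowStochastic hQ]
        simp
    _ = (1 - ε) * ∑ i, |z i| := by rw [← Finset.sum_mul, mul_comm]

/-- Each block of `N` steps contracts by `1 - ε`; the remaining `n % N` steps do not expand, which
is the case `ε = 0` of the one-step estimate. -/
theorem sum_abs_vecMul_pow_le (hQ : Q ∈ Matrix.rowStochastic ℝ S) {ε : ℝ} {j₀ : S} {N : ℕ}
    (hε : ∀ i, ε ≤ (Q ^ N) i j₀) (hε1 : ε ≤ 1) {z : S → ℝ} (hz : ∑ i, z i = 0) (n : ℕ) :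
    ∑ j, |Matrix.vecMul z (Q ^ n) j| ≤ (1 - ε) ^ (n / N) * ∑ i, |z i| := by
  have key : ∀ k, ∑ j, |Matrix.vecMul z (Q ^ (N * k)) j| ≤ (1 - ε) ^ k * ∑ i, |z i| := by
    intro k
    induction k with
    | zero => simp
    | succ k ih =>
      rw [Nat.mul_succ, pow_add, ← Matrix.vecMul_vecMul]
      refine (sum_abs_vecMul_le (pow_mem hQ N) hε
        ((sum_vecMul (pow_mem hQ _) z).trans hz)).trans ?_
      rw [pow_succ', mul_assoc]
      exact mul_le_mul_of_nonneg_left ih (by linarith)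
  conv_lhs => rw [← Nat.div_add_mod n N, pow_add]
  simp only [← Matrix.vecMul_vecMul]
  refine le_trans ?_ (key (n / N))
  have := sum_abs_vecMul_le (pow_mem hQ (n % N)) (ε := 0) (j₀ := j₀)
    (fun i => (pow_mem hQ (n % N)).1 _ _)
    (z := Matrix.vecMul z (Q ^ (N * (n / N)))) ((sum_vecMul (pow_mem hQ _) z).trans hz)
  simpa using this

/-- The convergence theorem for finite unichain aperiodic Markov chains. -/
theorem exists_tendsto_pow (hQ : Q ∈ Matrix.rowStochastic ℝ S) (hU : IsUnichain Q)
    (hA : IsAperiodic Q) :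
    ∃ π : S → ℝ, ∀ i j, Tendsto (fun n => (Q ^ n) i j) atTop (𝓝 (π j)) := by
  obtain ⟨N, hN, j₀, hpos⟩ := exists_pow_pos hQ hU hA
  obtain ⟨i₀, -, hi₀⟩ := Finset.exists_min_image Finset.univ (fun i => (Q ^ N) i j₀)
    ⟨j₀, Finset.mem_univ _⟩
  set ε := (Q ^ N) i₀ j₀ with hεdef
  have hε0 : 0 < ε := hpos i₀
  have hε1 : ε ≤ 1 := Matrix.le_one_of_mem_rowStochastic (pow_mem hQ N)
  have hε : ∀ i, ε ≤ (Q ^ N) i j₀ := fun i => hi₀ i (Finset.mem_univ i)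
  have hb : Tendsto (fun n : ℕ => (1 - ε) ^ (n / N) * 2) atTop (𝓝 0) := by
    have h1 : Tendsto (fun n : ℕ => n / N) atTop atTop :=
      Nat.tendsto_div_const_atTop hN.ne'
    have h2 := (tendsto_pow_atTop_nhds_zero_of_lt_one (r := 1 - ε) (by linarith) (by linarith))
    simpa using (h2.comp h1).mul_const 2
  have hrow : ∀ n i, ∑ j, |(Q ^ n) i j| = 1 := by
    intro n i
    rw [← Matrix.sum_row_of_mem_rowStochastic (pow_mem hQ n) i]
    exact Finset.sum_congr rfl fun j _ => abs_of_nonneg ((pow_mem hQ n).1 _ _)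
  -- Comparing two rows at two different times gives at once the Cauchy property (`i = i'`) and
  -- independence of the starting state (`m = k = 0`).
  have hmain : ∀ n m k i i' j,
      |(Q ^ (m + n)) i j - (Q ^ (k + n)) i' j| ≤ (1 - ε) ^ (n / N) * 2 := by
    intro n m k i i' j
    set z : S → ℝ := fun l => (Q ^ m) i l - (Q ^ k) i' l with hz
    have hz0 : ∑ l, z l = 0 := by
      simp [hz, Matrix.sum_row_of_mem_rowStochastic (pow_mem hQ _)]
    have hz2 : ∑ l, |z l| ≤ 2 := by
      calc ∑ l, |z l| ≤ ∑ l, (|(Q ^ m) i l| + |(Q ^ k) i' l|) :=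
            Finset.sum_le_sum fun l _ => abs_sub _ _
        _ = 2 := by rw [Finset.sum_add_distrib, hrow, hrow]; norm_num
    have hzj : (Q ^ (m + n)) i j - (Q ^ (k + n)) i' j = Matrix.vecMul z (Q ^ n) j := by
      simp only [pow_add, Matrix.mul_apply, Matrix.vecMul, dotProduct, hz, sub_mul,
        Finset.sum_sub_distrib]
    rw [hzj]
    have h1 : |Matrix.vecMul z (Q ^ n) j| ≤ ∑ j, |Matrix.vecMul z (Q ^ n) j| :=
      Finset.single_le_sum (f := fun j => |Matrix.vecMul z (Q ^ n) j|)
        (fun _ _ => abs_nonneg _) (Finset.mem_univ j)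
    refine (h1.trans (sum_abs_vecMul_pow_le hQ hε hε1 hz0 n)).trans ?_
    exact mul_le_mul_of_nonneg_left hz2 (pow_nonneg (by linarith) _)
  have hcauchy : ∀ i j, CauchySeq fun n => (Q ^ n) i j := by
    intro i j
    refine cauchySeq_of_le_tendsto_0 _ (fun n m k hn hm => ?_) hb
    obtain ⟨a, rfl⟩ := Nat.exists_eq_add_of_le' hn
    obtain ⟨b, rfl⟩ := Nat.exists_eq_add_of_le' hm
    exact hmain k a b i i j
  obtain ⟨π, hπ⟩ : ∃ π : S → ℝ, ∀ j, Tendsto (fun n => (Q ^ n) j₀ j) atTop (𝓝 (π j)) := by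
    choose π hπ using fun j => cauchySeq_tendsto_of_complete (hcauchy j₀ j)
    exact ⟨π, hπ⟩
  refine ⟨π, fun i j => ?_⟩
  have hdiff : Tendsto (fun n => (Q ^ n) i j - (Q ^ n) j₀ j) atTop (𝓝 0) := by
    refine squeeze_zero_norm (fun n => ?_) hb
    simpa using hmain n 0 0 i j₀ j
  simpa using hdiff.add (hπ j)

end MarkovChain

/-! ### Real-valued formulas for finite distributions. -/

section PMF

theorem toReal_bind_apply {ι κ : Type*} [Fintype ι] (p : PMF ι) (f : ι → PMF κ) (b : κ) :
    (p.bind f b).toReal = ∑ a, (p a).toReal * (f a b).toReal := by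
  rw [PMF.bind_apply, tsum_fintype, ENNReal.toReal_sum]
  · simp only [ENNReal.toReal_mul]
  · exact fun a _ => ENNReal.mul_ne_top (p.apply_ne_top a) ((f a).apply_ne_top b)

theorem sum_toReal {ι : Type*} [Fintype ι] (p : PMF ι) : ∑ a, (p a).toReal = 1 := by
  rw [← ENNReal.toReal_sum fun a _ => p.apply_ne_top a, ← tsum_fintype (L := .unconditional _),
    p.tsum_coe, ENNReal.toReal_one]

theorem toReal_map_fst {S : Type*} {A : S → Type*} [Fintype S] [∀ i, Fintype (A i)]
    (p : PMF (Pairs S A)) (j : S) :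
    (p.map Sigma.fst j).toReal = ∑ a, (p ⟨j, a⟩).toReal := by
  classical
  rw [← PMF.bind_pure_comp, toReal_bind_apply, Fintype.sum_sigma, Finset.sum_eq_single j]
  · simp
  · intro i _ hij
    refine Finset.sum_eq_zero fun a _ => ?_
    simp [PMF.pure_apply_of_ne _ _ hij.symm]
  · simp

theorem toReal_bind_map_mk {S : Type*} {A : S → Type*} [Fintype S] [∀ i, Fintype (A i)]
    (p : PMF S) (d : (i : S) → PMF (A i)) (i : S) (a : A i) :
    (p.bind (fun i => (d i).map (Sigma.mk i)) ⟨i, a⟩).toReal = (p i).toReal * (d i a).toReal := by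
  classical
  rw [toReal_bind_apply, Finset.sum_eq_single i]
  · congr 2
    rw [PMF.map_apply, tsum_eq_single a]
    · simp
    · intro b hb
      simp [hb.symm]
  · intro k _ hk
    have : ((d k).map (Sigma.mk k)) ⟨i, a⟩ = 0 := by
      rw [PMF.apply_eq_zero_iff, PMF.mem_support_map_iff]
      rintro ⟨b, -, hb⟩
      exact hk (congrArg Sigma.fst hb)
    simp [this]
  · simp

end PMF

namespace MDP

/-! ### Laws of state-action pairs and rewards. -/

section Laws

variable {S : Type*} {A : S → Type*} (M : MDP S A)

/-- The probability that the state-action pair at time `t` is `k`. -/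
noncomputable def pairProb (u : Policy S A) (s : S) (t : ℕ) (k : Pairs S A) : ℝ :=
  (M.pairLaw u s t k).toReal

theorem pairLaw_map_fst (u : Policy S A) (s : S) (t : ℕ) :
    (M.pairLaw u s t).map Sigma.fst = (M.historyLaw u s t).map Prod.snd := by
  rw [pairLaw, PMF.map_bind, ← PMF.bind_pure_comp]
  congr 1
  funext h
  rw [PMF.map_comp]
  exact PMF.map_const _ _

/-- However the policy uses the past, the next state depends on it only through the current pair.
This yields the flow equation `sum_pairProb_succ` for arbitrary policies. -/
theorem historyLaw_succ_map_snd (u : Policy S A) (s : S) (t : ℕ) :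
    (M.historyLaw u s (t + 1)).map Prod.snd = (M.pairLaw u s t).bind fun k => M.P k.1 k.2 := by
  rw [historyLaw, pairLaw, PMF.map_bind, PMF.bind_bind]
  congr 1
  funext h
  rw [PMF.map_bind, PMF.bind_map]
  congr 1
  funext a
  rw [PMF.map_comp]
  exact PMF.map_id _

theorem pairLaw_stationary (d : Stationary S A) (s : S) (t : ℕ) :
    M.pairLaw d.toPolicy s t =
      ((M.historyLaw d.toPolicy s t).map Prod.snd).bind fun i => (d i).map (Sigma.mk i) := by
  rw [pairLaw, PMF.bind_map]
  rfl

theorem rewardLaw_eq_map (u : Policy S A) (s : S) (t : ℕ) :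
    M.rewardLaw u s t = @Measure.map _ _ ⊤ _ (fun k : Pairs S A => M.r k.1 k.2)
      (@PMF.toMeasure _ ⊤ (M.pairLaw u s t)) := by
  let _ : MeasurableSpace (Pairs S A) := ⊤
  exact (PMF.toMeasure_map _ (M.pairLaw u s t) measurable_from_top).symm

instance (u : Policy S A) (s : S) (t : ℕ) : IsProbabilityMeasure (M.rewardLaw u s t) := by
  rw [rewardLaw]; infer_instance

variable [Fintype S]

theorem transition_mem_rowStochastic [DecidableEq S] (d : Stationary S A) :
    M.transition d ∈ Matrix.rowStochastic ℝ S := by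
  rw [Matrix.mem_rowStochastic_iff_sum]
  exact ⟨fun _ _ => ENNReal.toReal_nonneg, fun i => sum_toReal _⟩

theorem historyLaw_stationary [DecidableEq S] (d : Stationary S A) (s : S) (t : ℕ) (i : S) :
    ((M.historyLaw d.toPolicy s t).map Prod.snd i).toReal = (M.transition d ^ t) s i := by
  induction t generalizing i with
  | zero =>
    rw [historyLaw, PMF.pure_map, PMF.pure_apply, pow_zero, Matrix.one_apply]
    rcases eq_or_ne i s with rfl | h
    · simp
    · simp [h, h.symm]
  | succ t ih =>
    rw [historyLaw_succ_map_snd, pairLaw_stationary, PMF.bind_bind, toReal_bind_apply, pow_succ,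
      Matrix.mul_apply]
    refine Finset.sum_congr rfl fun k _ => ?_
    rw [ih, PMF.bind_map]
    rfl

variable [∀ i, Fintype (A i)]

theorem pairProb_mem_stdSimplex (u : Policy S A) (s : S) (t : ℕ) :
    M.pairProb u s t ∈ stdSimplex ℝ (Pairs S A) :=
  ⟨fun _ => ENNReal.toReal_nonneg, sum_toReal _⟩

theorem sum_pairProb_succ (u : Policy S A) (s : S) (t : ℕ) (j : S) :
    ∑ a, M.pairProb u s (t + 1) ⟨j, a⟩ =
      ∑ k : Pairs S A, (M.P k.1 k.2 j).toReal * M.pairProb u s t k := by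
  simp only [pairProb]
  rw [← toReal_map_fst, pairLaw_map_fst, historyLaw_succ_map_snd, toReal_bind_apply]
  simp only [mul_comm]

theorem pairProb_stationary [DecidableEq S] (d : Stationary S A) (s : S) (t : ℕ) (i : S) (a : A i) :
    M.pairProb d.toPolicy s t ⟨i, a⟩ = (M.transition d ^ t) s i * (d i a).toReal := by
  rw [pairProb, pairLaw_stationary, toReal_bind_map_mk, historyLaw_stationary]

theorem integral_rewardLaw (u : Policy S A) (s : S) (t : ℕ) {f : ℝ → ℝ} (hf : Measurable f) :
    ∫ x, f x ∂(M.rewardLaw u s t) = ∑ k : Pairs S A, M.pairProb u s t k * f (M.r k.1 k.2) := by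
  let _ : MeasurableSpace (Pairs S A) := ⊤
  have : MeasurableSingletonClass (Pairs S A) := ⟨fun _ => trivial⟩
  rw [rewardLaw_eq_map, integral_map measurable_from_top.aemeasurable hf.aestronglyMeasurable,
    PMF.integral_eq_sum]
  rfl

theorem integral_id_rewardLaw (u : Policy S A) (s : S) (t : ℕ) :
    ∫ x, x ∂(M.rewardLaw u s t) = ∑ k : Pairs S A, M.pairProb u s t k * M.r k.1 k.2 :=
  M.integral_rewardLaw u s t measurable_id

theorem integrable_rewardLaw (u : Policy S A) (s : S) (t : ℕ) {f : ℝ → ℝ} (hf : Measurable f) :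
    Integrable f (M.rewardLaw u s t) := by
  let _ : MeasurableSpace (Pairs S A) := ⊤
  have : MeasurableSingletonClass (Pairs S A) := ⟨fun _ => trivial⟩
  rw [rewardLaw_eq_map, integrable_map_measure hf.aestronglyMeasurable
    measurable_from_top.aemeasurable]
  exact .of_finite

theorem le_iSup_r (k : Pairs S A) : M.r k.1 k.2 ≤ ⨆ k : Pairs S A, M.r k.1 k.2 :=
  le_ciSup (f := fun k : Pairs S A => M.r k.1 k.2) (Set.finite_range _).bddAbove k

theorem iInf_r_le (k : Pairs S A) : ⨅ k : Pairs S A, M.r k.1 k.2 ≤ M.r k.1 k.2 :=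
  ciInf_le (f := fun k : Pairs S A => M.r k.1 k.2) (Set.finite_range _).bddBelow k

theorem ae_rewardLaw_mem_Y (u : Policy S A) (s : S) (t : ℕ) :
    ∀ᵐ x ∂(M.rewardLaw u s t), x ∈ M.Y := by
  let _ : MeasurableSpace (Pairs S A) := ⊤
  rw [rewardLaw_eq_map, ae_map_iff measurable_from_top.aemeasurable (p := fun x => x ∈ M.Y)
    measurableSet_Icc]
  exact ae_of_all _ fun k => ⟨M.iInf_r_le k, M.le_iSup_r k⟩

theorem saddleFun_eq {α β : ℝ} {x : Pairs S A → ℝ} (hx : ∑ k, x k = 1) (y : ℝ) :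
    M.saddleFun α β x y = y + (1 / (1 - α)) * ∑ k, x k * max (M.r k.1 k.2 - y) 0 +
      β * ∑ k, x k * M.r k.1 k.2 := by
  calc M.saddleFun α β x y
      = ∑ k, (y * x k + (1 / (1 - α)) * (x k * max (M.r k.1 k.2 - y) 0) +
          β * (x k * M.r k.1 k.2)) := Finset.sum_congr rfl fun k _ => by ring
    _ = _ := by
        rw [Finset.sum_add_distrib, Finset.sum_add_distrib, ← Finset.mul_sum, ← Finset.mul_sum,
          ← Finset.mul_sum, hx, mul_one]

/-- The mean-CVaR of the reward at time `t` is the minimum of the saddle function. -/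
theorem isLeast_saddleFun_pairProb {α : ℝ} (hα : α ∈ Set.Ioo (0 : ℝ) 1) (β : ℝ) (u : Policy S A)
    (s : S) (t : ℕ) :
    IsLeast (M.saddleFun α β (M.pairProb u s t) '' M.Y)
      (CVaR α (M.rewardLaw u s t) + β * ∫ x, x ∂(M.rewardLaw u s t)) := by
  have hs := (M.pairProb_mem_stdSimplex u s t).2
  have hi := M.integrable_rewardLaw u s t measurable_id
  have hm : ∀ y : ℝ, Measurable fun x : ℝ => max (x - y) 0 := fun y => by fun_prop
  constructor
  · refine ⟨VaR (M.rewardLaw u s t) α, VaR_mem_Icc hα (M.ae_rewardLaw_mem_Y u s t), ?_⟩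
    rw [saddleFun_eq _ hs, CVaR_eq hα hi, integral_rewardLaw _ _ _ _ (hm _),
      integral_id_rewardLaw]
  · rintro _ ⟨y, -, rfl⟩
    rw [saddleFun_eq _ hs]
    have h := CVaR_le hα hi y
    rw [integral_rewardLaw _ _ _ _ (hm _)] at h
    rw [integral_id_rewardLaw]
    linarith

end Laws

end MDP

namespace MDP

variable {S : Type*} {A : S → Type*} (M : MDP S A)

theorem isCompact_Y : IsCompact M.Y := isCompact_Icc

variable [Fintype S] [∀ i, Fintype (A i)]

/-! ### The polytope of steady-state distributions. -/

section Polytope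

/-- The balance defect of `x` at the state `j`. -/
def balance (j : S) (x : Pairs S A → ℝ) : ℝ :=
  ∑ a : A j, x ⟨j, a⟩ - ∑ k : Pairs S A, (M.P k.1 k.2 j).toReal * x k

theorem mem_X_iff {x : Pairs S A → ℝ} :
    x ∈ M.X ↔ (∀ j, M.balance j x = 0) ∧ x ∈ stdSimplex ℝ (Pairs S A) := by
  simp only [X, balance, sub_eq_zero, stdSimplex, Set.mem_ofPred_eq]
  tauto

@[fun_prop]
theorem continuous_balance (j : S) : Continuous (M.balance j) := by
  unfold balance; fun_prop

theorem balance_add_smul (j : S) (x z : Pairs S A → ℝ) (c : ℝ) :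
    M.balance j (x + c • z) = M.balance j x + c * M.balance j z := by
  simp only [balance, Pi.add_apply, Pi.smul_apply, smul_eq_mul, mul_add, Finset.sum_add_distrib,
    mul_sub, Finset.mul_sum, mul_left_comm c]
  ring

theorem isCompact_X : IsCompact M.X := by
  have h : M.X = (⋂ j, M.balance j ⁻¹' {0}) ∩ stdSimplex ℝ (Pairs S A) := by
    ext x
    simp [mem_X_iff]
  rw [h]
  exact (isCompact_stdSimplex ℝ (Pairs S A)).inter_left
    (isClosed_iInter fun j => isClosed_singleton.preimage (M.continuous_balance j))

theorem convex_X : Convex ℝ M.X := by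
  intro x hx z hz a b ha hb hab
  rw [mem_X_iff] at *
  refine ⟨fun j => ?_, convex_stdSimplex ℝ _ hx.2 hz.2 ha hb hab⟩
  have h := M.balance_add_smul j (a • x) z b
  have h' := M.balance_add_smul j 0 x a
  have h0 : M.balance j 0 = 0 := by simp [balance]
  rw [zero_add, h0, hx.1] at h'
  rw [h, h', hz.1]
  ring

end Polytope

/-! ### The saddle function and its minimum over `𝕐`. -/

section SaddleFunction

variable (α β : ℝ)

theorem nonempty_Y [Nonempty S] [∀ i, Nonempty (A i)] : M.Y.Nonempty := by
  let k : Pairs S A := ⟨Classical.arbitrary S, Classical.arbitrary _⟩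
  exact ⟨M.r k.1 k.2, M.iInf_r_le k, M.le_iSup_r k⟩

theorem continuous_saddleFun :
    Continuous fun p : (Pairs S A → ℝ) × ℝ => M.saddleFun α β p.1 p.2 := by
  unfold saddleFun; fun_prop

theorem continuous_saddleFun_left (y : ℝ) : Continuous fun x => M.saddleFun α β x y := by
  unfold saddleFun; fun_prop

theorem continuous_saddleFun_right (x : Pairs S A → ℝ) : Continuous (M.saddleFun α β x) := by
  unfold saddleFun; fun_prop

theorem saddleFun_combo (x z : Pairs S A → ℝ) (a b y : ℝ) :
    M.saddleFun α β (a • x + b • z) y = a * M.saddleFun α β x y + b * M.saddleFun α β z y := by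
  simp only [saddleFun, Finset.mul_sum, ← Finset.sum_add_distrib]
  refine Finset.sum_congr rfl fun k _ => ?_
  simp only [Pi.add_apply, Pi.smul_apply, smul_eq_mul]
  ring

theorem saddleFun_sum {ι : Type*} (I : Finset ι) (x : ι → Pairs S A → ℝ) (y : ℝ) :
    M.saddleFun α β (∑ i ∈ I, x i) y = ∑ i ∈ I, M.saddleFun α β (x i) y := by
  simp only [saddleFun]
  rw [Finset.sum_comm]
  refine Finset.sum_congr rfl fun k _ => ?_
  rw [Finset.sum_apply, Finset.sum_mul]

theorem saddleFun_smul (c : ℝ) (x : Pairs S A → ℝ) (y : ℝ) :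
    M.saddleFun α β (c • x) y = c * M.saddleFun α β x y := by
  simpa using M.saddleFun_combo α β x 0 c 0 y

theorem convexOn_saddleFun {α : ℝ} (hα : α < 1) {x : Pairs S A → ℝ} (hx : ∀ k, 0 ≤ x k) :
    ConvexOn ℝ Set.univ (M.saddleFun α β x) := by
  refine ⟨convex_univ, fun y _ y' _ a b ha hb hab => ?_⟩
  have h0 : 0 ≤ 1 / (1 - α) := by
    have : 0 < 1 - α := by linarith
    positivity
  simp only [saddleFun, smul_eq_mul, Finset.mul_sum, ← Finset.sum_add_distrib]
  refine Finset.sum_le_sum fun k _ => ?_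
  have hmax : max (M.r k.1 k.2 - (a * y + b * y')) 0 ≤
      a * max (M.r k.1 k.2 - y) 0 + b * max (M.r k.1 k.2 - y') 0 := by
    refine max_le ?_ (by positivity)
    have h1 := mul_le_mul_of_nonneg_left (le_max_left (M.r k.1 k.2 - y) 0) ha
    have h2 := mul_le_mul_of_nonneg_left (le_max_left (M.r k.1 k.2 - y') 0) hb
    have h3 : M.r k.1 k.2 = a * M.r k.1 k.2 + b * M.r k.1 k.2 := by rw [← add_mul, hab, one_mul]
    linarith
  have h4 := mul_le_mul_of_nonneg_left hmax h0
  have h5 : β * M.r k.1 k.2 = a * (β * M.r k.1 k.2) + b * (β * M.r k.1 k.2) := by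
    rw [← add_mul, hab, one_mul]
  rw [mul_left_comm a, mul_left_comm b, ← mul_add]
  refine mul_le_mul_of_nonneg_left ?_ (hx k)
  rw [mul_add, mul_left_comm _ a, mul_left_comm _ b] at h4
  linarith

/-- The mean-CVaR of the rewards under the steady-state distribution `x`, written as the minimum of
the saddle function over `𝕐`. -/
noncomputable def value (x : Pairs S A → ℝ) : ℝ := sInf (M.saddleFun α β x '' M.Y)

theorem continuous_value : Continuous (M.value α β) :=
  M.isCompact_Y.continuous_sInf (f := M.saddleFun α β) (M.continuous_saddleFun α β)

theorem isLeast_value [Nonempty S] [∀ i, Nonempty (A i)] (x : Pairs S A → ℝ) :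
    IsLeast (M.saddleFun α β x '' M.Y) (M.value α β x) :=
  (M.isCompact_Y.image (M.continuous_saddleFun_right α β x)).isLeast_sInf (M.nonempty_Y.image _)

theorem value_le [Nonempty S] [∀ i, Nonempty (A i)] (x : Pairs S A → ℝ) {y : ℝ} (hy : y ∈ M.Y) :
    M.value α β x ≤ M.saddleFun α β x y :=
  (M.isLeast_value α β x).2 ⟨y, hy, rfl⟩

variable {α}

/-- The criterion becomes a function of the pair law alone; quantiles play no further role. -/
theorem comb_eq_value (hα : α ∈ Set.Ioo (0 : ℝ) 1) (u : Policy S A) (s : S) (t : ℕ) :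
    CVaR α (M.rewardLaw u s t) + β * ∫ x, x ∂(M.rewardLaw u s t) =
      M.value α β (M.pairProb u s t) :=
  (M.isLeast_saddleFun_pairProb hα β u s t).csInf_eq.symm

theorem cvar_eq_value (hα : α ∈ Set.Ioo (0 : ℝ) 1) (u : Policy S A) (s : S) (t : ℕ) :
    CVaR α (M.rewardLaw u s t) = M.value α 0 (M.pairProb u s t) := by
  simpa using M.comb_eq_value 0 hα u s t

/-- The mean term does not involve `y`, so it leaves the minimum; this splits the limit into a CVaR
part and a mean part. -/
theorem value_eq_add [Nonempty S] [∀ i, Nonempty (A i)] {x : Pairs S A → ℝ} (hx : ∑ k, x k = 1) :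
    M.value α β x = M.value α 0 x + β * ∑ k, x k * M.r k.1 k.2 := by
  have key : ∀ y, M.saddleFun α β x y = M.saddleFun α 0 x y + β * ∑ k, x k * M.r k.1 k.2 :=
    fun y => by rw [saddleFun_eq _ hx, saddleFun_eq _ hx]; ring
  obtain ⟨y, hy, h⟩ := (M.isLeast_value α β x).1
  obtain ⟨y', hy', h'⟩ := (M.isLeast_value α 0 x).1
  have h1 := M.value_le α β x hy'
  have h2 := M.value_le α 0 x hy
  rw [key] at h h1
  linarith

end SaddleFunction

/-! ### Empirical frequencies and the upper bound for all policies. -/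

section Averages

variable (u : Policy S A) (s : S)

/-- The empirical state-action frequencies over the first `T` periods. -/
noncomputable def freq (T : ℕ) : Pairs S A → ℝ := (1 / (T : ℝ)) • ∑ t ∈ Finset.range T, M.pairProb u s t

theorem freq_mem_stdSimplex {T : ℕ} (hT : 0 < T) :
    M.freq u s T ∈ stdSimplex ℝ (Pairs S A) := by
  have hT' : (T : ℝ) ≠ 0 := by positivity
  refine ⟨fun k => ?_, ?_⟩
  · rw [freq, Pi.smul_apply, Finset.sum_apply, smul_eq_mul]
    exact mul_nonneg (by positivity)
      (Finset.sum_nonneg fun t _ => (M.pairProb_mem_stdSimplex u s t).1 k)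
  · simp only [freq, Pi.smul_apply, Finset.sum_apply, smul_eq_mul]
    rw [← Finset.mul_sum, Finset.sum_comm]
    simp only [(M.pairProb_mem_stdSimplex u s _).2, Finset.sum_const, Finset.card_range,
      nsmul_eq_mul, mul_one]
    field_simp

/-- The inflow into `j` at time `t` is the marginal at time `t + 1`, so the sum of the defects
telescopes. -/
theorem balance_freq (T : ℕ) (j : S) :
    M.balance j (M.freq u s T) = (1 / (T : ℝ)) *
      (∑ a, M.pairProb u s 0 ⟨j, a⟩ - ∑ a, M.pairProb u s T ⟨j, a⟩) := by
  have h : ∀ n, M.balance j (∑ t ∈ Finset.range n, M.pairProb u s t) =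
      ∑ a, M.pairProb u s 0 ⟨j, a⟩ - ∑ a, M.pairProb u s n ⟨j, a⟩ := by
    intro n
    induction n with
    | zero => simp [balance]
    | succ n ih =>
      have h1 := M.balance_add_smul j (∑ t ∈ Finset.range n, M.pairProb u s t)
        (M.pairProb u s n) 1
      rw [one_smul, ih, one_mul] at h1
      rw [Finset.sum_range_succ, h1, sum_pairProb_succ, balance]
      ring
  have h2 := M.balance_add_smul j 0 (∑ t ∈ Finset.range T, M.pairProb u s t) (1 / (T : ℝ))
  rw [zero_add, h] at h2
  rw [freq, h2]
  simp [balance]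

theorem tendsto_balance_freq (j : S) :
    Tendsto (fun T => M.balance j (M.freq u s T)) atTop (𝓝 0) := by
  simp only [balance_freq]
  have hb : ∀ t, ∑ a, M.pairProb u s t ⟨j, a⟩ ∈ Set.Icc (0 : ℝ) 1 := by
    intro t
    have hm := M.pairProb_mem_stdSimplex u s t
    refine ⟨Finset.sum_nonneg fun a _ => hm.1 _, ?_⟩
    rw [← hm.2, Fintype.sum_sigma]
    exact Finset.single_le_sum (f := fun i => ∑ a, M.pairProb u s t ⟨i, a⟩)
      (fun i _ => Finset.sum_nonneg fun a _ => hm.1 _) (Finset.mem_univ j)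
  refine squeeze_zero_norm (a := fun T : ℕ => 1 / (T : ℝ)) (fun T => ?_)
    tendsto_one_div_atTop_nhds_zero_nat
  rw [norm_mul, Real.norm_eq_abs, Real.norm_eq_abs, abs_of_nonneg (by positivity : 0 ≤ 1 / (T : ℝ))]
  refine mul_le_of_le_one_right (by positivity) ?_
  rw [abs_le]
  constructor <;> linarith [(hb 0).1, (hb 0).2, (hb T).1, (hb T).2]

/-- Closed sets that are visited infinitely often by the frequencies meet the polytope. -/
theorem exists_mem_X_of_frequently {F : Set (Pairs S A → ℝ)} (hF : IsClosed F)
    (h : ∃ᶠ T in atTop, M.freq u s T ∈ F) : ∃ x ∈ M.X, x ∈ F := by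
  have h' : ∃ᶠ T in atTop, M.freq u s T ∈ stdSimplex ℝ (Pairs S A) ∩ F := by
    refine (h.and_eventually (eventually_gt_atTop 0)).mono fun T hT => ?_
    exact ⟨M.freq_mem_stdSimplex u s hT.2, hT.1⟩
  obtain ⟨x, hx, hcl⟩ :=
    ((isCompact_stdSimplex ℝ (Pairs S A)).inter_right hF).exists_mapClusterPt_of_frequently h'
  refine ⟨x, M.mem_X_iff.2 ⟨fun j => ?_, hx.1⟩, hx.2⟩
  have h1 : MapClusterPt (M.balance j x) atTop (M.balance j ∘ M.freq u s) :=
    hcl.continuousAt_comp (M.continuous_balance j).continuousAt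
  have h2 : MapClusterPt (M.balance j x) atTop (M.balance j ∘ M.freq u s) → M.balance j x = 0 :=
    fun h => by
      by_contra hne
      have hd : Disjoint (𝓝 (M.balance j x)) (𝓝 0) := disjoint_nhds_nhds.2 hne
      exact (h.clusterPt.neBot).ne (hd.mono_right (M.tendsto_balance_freq u s j)).eq_bot
  exact h2 h1

/-- Steady states exist because the frequencies of any policy cluster in `𝕏`. -/
theorem nonempty_X [Nonempty S] [∀ i, Nonempty (A i)] : M.X.Nonempty := by
  obtain ⟨x, hx, -⟩ := M.exists_mem_X_of_frequently
    (fun _ _ i => PMF.pure (Classical.arbitrary (A i))) (Classical.arbitrary S) isClosed_univ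
    (Frequently.of_forall fun _ => Set.mem_univ _)
  exact ⟨x, hx⟩

variable {α : ℝ} (β : ℝ)

/-- Real `limsup` and `liminf` are meaningful only for bounded sequences. All pair laws lie in the
compact simplex, on which `value` is bounded. -/
theorem exists_abs_combAvg_le (hα : α ∈ Set.Ioo (0 : ℝ) 1) :
    ∃ B, ∀ u s T, |M.combAvg α β u s T| ≤ B := by
  obtain ⟨B, hB⟩ := (isCompact_stdSimplex ℝ (Pairs S A)).exists_bound_of_continuousOn
    (M.continuous_value α β).continuousOn
  -- The maximum with `0` covers `T = 0`, where the average is `0`.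
  refine ⟨max B 0, fun u s T => ?_⟩
  rw [combAvg, abs_mul, abs_of_nonneg (by positivity : 0 ≤ 1 / (T : ℝ))]
  have h1 : |∑ t ∈ Finset.range T,
      (CVaR α (M.rewardLaw u s t) + β * ∫ x, x ∂(M.rewardLaw u s t))| ≤ T * max B 0 := by
    refine (Finset.abs_sum_le_sum_abs _ _).trans ?_
    have := Finset.sum_le_card_nsmul (Finset.range T) (fun t =>
      |CVaR α (M.rewardLaw u s t) + β * ∫ x, x ∂(M.rewardLaw u s t)|) (max B 0) fun t _ => by
        rw [comb_eq_value _ _ hα]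
        exact (hB _ (M.pairProb_mem_stdSimplex u s t)).trans (le_max_left _ _)
    simpa using this
  refine (mul_le_mul_of_nonneg_left h1 (by positivity)).trans ?_
  rcases Nat.eq_zero_or_pos T with rfl | hT
  · simp
  · rw [← mul_assoc, one_div, inv_mul_cancel₀ (by positivity), one_mul]

theorem Jinf_le_Jsup (hα : α ∈ Set.Ioo (0 : ℝ) 1) : M.Jinf α β u s ≤ M.Jsup α β u s := by
  obtain ⟨B, hB⟩ := M.exists_abs_combAvg_le β hα
  exact liminf_le_limsup (isBoundedUnder_of ⟨B, fun T => (abs_le.1 (hB u s T)).2⟩)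
    (isBoundedUnder_of ⟨-B, fun T => (abs_le.1 (hB u s T)).1⟩)

variable [Nonempty S] [∀ i, Nonempty (A i)]

/-- Using one `y` at all times replaces every minimum by a function linear in the pair law, which
commutes with averaging. -/
theorem combAvg_le (hα : α ∈ Set.Ioo (0 : ℝ) 1) {y : ℝ} (hy : y ∈ M.Y) (T : ℕ) :
    M.combAvg α β u s T ≤ M.saddleFun α β (M.freq u s T) y := by
  rw [combAvg, freq, saddleFun_smul, saddleFun_sum]
  refine mul_le_mul_of_nonneg_left (Finset.sum_le_sum fun t _ => ?_) (by positivity)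
  rw [comb_eq_value _ _ hα]
  exact M.value_le α β _ hy

/-- If the averages exceeded `V + ε` infinitely often, a cluster point of the frequencies would be a
point of `𝕏` with saddle function at least `V + ε`. -/
theorem Jsup_le (hα : α ∈ Set.Ioo (0 : ℝ) 1) {y V : ℝ} (hy : y ∈ M.Y)
    (hV : ∀ x ∈ M.X, M.saddleFun α β x y ≤ V) : M.Jsup α β u s ≤ V := by
  obtain ⟨B, hB⟩ := M.exists_abs_combAvg_le β hα
  refine le_of_forall_pos_le_add fun ε hε => ?_
  refine limsup_le_of_le ⟨-B, fun b hb => ?_⟩ ?_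
  · obtain ⟨T, hT⟩ := (eventually_map.1 hb).exists
    exact (neg_le_of_abs_le (hB u s T)).trans hT
  · by_contra hcon
    have hfr : ∃ᶠ T in atTop, M.freq u s T ∈ {x | V + ε ≤ M.saddleFun α β x y} := by
      refine (not_eventually.1 hcon).mono fun T hT => ?_
      exact (not_le.1 hT).le.trans (M.combAvg_le u s β hα hy T)
    obtain ⟨x, hx, hx'⟩ := M.exists_mem_X_of_frequently u s
      (isClosed_le continuous_const (M.continuous_saddleFun_left α β y)) hfr
    have h1 := hV x hx
    have h2 : V + ε ≤ M.saddleFun α β x y := hx'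
    linarith

end Averages

end MDP

namespace MDP

variable {S : Type*} {A : S → Type*} {M : MDP S A}

/-! ### From an upper bound on the limsup to optimality. -/

section Limits

variable {α β : ℝ} {u : Policy S A} {s : S}

theorem J_eq {V : ℝ} (h : Tendsto (M.combAvg α β u s) atTop (𝓝 V)) : M.J α β u s = V :=
  h.limUnder_eq

theorem Jsup_eq {V : ℝ} (h : Tendsto (M.combAvg α β u s) atTop (𝓝 V)) : M.Jsup α β u s = V :=
  h.limsup_eq

theorem Jinf_eq {V : ℝ} (h : Tendsto (M.combAvg α β u s) atTop (𝓝 V)) : M.Jinf α β u s = V :=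
  h.liminf_eq

theorem WellDefined.J_eq_Jsup (h : M.WellDefined α β u) : M.J α β u s = M.Jsup α β u s := by
  obtain ⟨l, hl⟩ := h s
  rw [J_eq hl, Jsup_eq hl]

variable {V : ℝ} (hV : ∀ u s, M.Jsup α β u s ≤ V)
  (hu : ∀ s, Tendsto (M.combAvg α β u s) atTop (𝓝 V))
include hV hu

theorem isOptimal_of_tendsto : M.IsOptimal α β u := by
  refine ⟨fun s => ⟨V, hu s⟩, fun u' hu' s => ?_⟩
  rw [J_eq (hu s), hu'.J_eq_Jsup]
  exact hV u' s

theorem isSupOptimal_of_tendsto : M.IsSupOptimal α β u := fun u' s => by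
  rw [Jsup_eq (hu s)]
  exact hV u' s

end Limits

variable [Fintype S] [∀ i, Fintype (A i)]

/-! ### Stationary policies and their steady states. -/

section SteadyState

theorem mem_X_of_tendsto {u : Policy S A} {s : S} {x : Pairs S A → ℝ}
    (h : Tendsto (M.pairProb u s) atTop (𝓝 x)) : x ∈ M.X := by
  refine M.mem_X_iff.2 ⟨fun j => ?_, (isClosed_stdSimplex ℝ _).mem_of_tendsto h
    (Eventually.of_forall (M.pairProb_mem_stdSimplex u s))⟩
  have h1 : Tendsto (fun t => ∑ a, M.pairProb u s (t + 1) ⟨j, a⟩) atTop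
      (𝓝 (∑ a, x ⟨j, a⟩)) :=
    tendsto_finsetSum _ fun a _ => ((tendsto_pi_nhds.1 h) ⟨j, a⟩).comp (tendsto_add_atTop_nat 1)
  have h2 : Tendsto (fun t => ∑ k : Pairs S A, (M.P k.1 k.2 j).toReal * M.pairProb u s t k) atTop
      (𝓝 (∑ k : Pairs S A, (M.P k.1 k.2 j).toReal * x k)) :=
    tendsto_finsetSum _ fun k _ => ((tendsto_pi_nhds.1 h) k).const_mul _
  simp only [sum_pairProb_succ] at h1
  rw [balance, tendsto_nhds_unique h1 h2, sub_self]

variable [DecidableEq S]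

theorem exists_tendsto_pairProb (hM : M.UnichainAperiodic) (d : Stationary S A) :
    ∃ x, ∀ s, Tendsto (M.pairProb d.toPolicy s) atTop (𝓝 x) := by
  obtain ⟨π, hπ⟩ := exists_tendsto_pow (M.transition_mem_rowStochastic d) (hM d).1 (hM d).2
  refine ⟨fun k => π k.1 * (d k.1 k.2).toReal, fun s => tendsto_pi_nhds.2 fun k => ?_⟩
  have h : (fun t => M.pairProb d.toPolicy s t k) =
      fun t => (M.transition d ^ t) s k.1 * (d k.1 k.2).toReal :=
    funext fun t => M.pairProb_stationary d s t k.1 k.2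
  rw [h]
  exact (hπ s k.1).mul_const _

-- The product form also holds at states of mass zero, which is why the arbitrary choice there is
-- harmless.
omit [Fintype S] [DecidableEq S] in
theorem ReadOff.eq_mul {x : Pairs S A → ℝ} {d : Stationary S A} (hx : ∀ k, 0 ≤ x k)
    (hd : ReadOff x d) (i : S) (a : A i) :
    x ⟨i, a⟩ = (∑ a', x ⟨i, a'⟩) * (d i a).toReal := by
  rcases (Finset.sum_nonneg fun a' (_ : a' ∈ Finset.univ) => hx ⟨i, a'⟩).eq_or_lt with h | h
  · rw [← h, zero_mul]
    exact (Finset.sum_eq_zero_iff_of_nonneg fun a' _ => hx ⟨i, a'⟩).1 h.symm a (Finset.mem_univ a)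
  · rw [hd i h a]
    field_simp

/-- The state-action frequencies under a policy read off from `x` converge to `x`. -/
theorem tendsto_pairProb_of_readOff (hM : M.UnichainAperiodic) {x : Pairs S A → ℝ} (hx : x ∈ M.X)
    {d : Stationary S A} (hd : ReadOff x d) (s : S) :
    Tendsto (M.pairProb d.toPolicy s) atTop (𝓝 x) := by
  obtain ⟨π, hπ⟩ := exists_tendsto_pow (M.transition_mem_rowStochastic d) (hM d).1 (hM d).2
  have hX := M.mem_X_iff.1 hx
  have hmul := ReadOff.eq_mul hX.2.1 hd
  set μ : S → ℝ := fun i => ∑ a', x ⟨i, a'⟩ with hμ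
  have hstep : Matrix.vecMul μ (M.transition d) = μ := by
    funext j
    have h1 := hX.1 j
    rw [balance, sub_eq_zero, Fintype.sum_sigma] at h1
    change ∑ i, μ i * M.transition d i j = μ j
    refine Eq.trans (Finset.sum_congr rfl fun i _ => ?_) h1.symm
    rw [transition, toReal_bind_apply, Finset.mul_sum]
    refine Finset.sum_congr rfl fun a _ => ?_
    rw [hmul i a]
    ring
  have hpow : ∀ n, Matrix.vecMul μ (M.transition d ^ n) = μ := by
    intro n
    induction n with
    | zero => simp
    | succ n ih => rw [pow_succ, ← Matrix.vecMul_vecMul, ih, hstep]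
  have hμ1 : ∑ i, μ i = 1 := by
    rw [← hX.2.2, Fintype.sum_sigma]
  -- `μ` is invariant under every power, while all rows of the powers tend to `π`.
  have hπμ : ∀ j, π j = μ j := by
    intro j
    have h1 : Tendsto (fun n => ∑ i, μ i * (M.transition d ^ n) i j) atTop
        (𝓝 (∑ i, μ i * π j)) := tendsto_finsetSum _ fun i _ => (hπ i j).const_mul _
    have h2 : (fun n => ∑ i, μ i * (M.transition d ^ n) i j) = fun _ => μ j :=
      funext fun n => congrFun (hpow n) j
    rw [h2, ← Finset.sum_mul, hμ1, one_mul] at h1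
    exact tendsto_nhds_unique h1 tendsto_const_nhds
  refine tendsto_pi_nhds.2 fun ⟨i, a⟩ => ?_
  simp only [pairProb_stationary]
  rw [hmul i a]
  change Tendsto _ _ (𝓝 (μ i * _))
  rw [← hπμ]
  exact (hπ s i).mul_const _

-- At states of mass zero a point mass is chosen, so that they contribute no randomization.
omit [Fintype S] [DecidableEq S] in
theorem exists_readOff [∀ i, Nonempty (A i)] {x : Pairs S A → ℝ} (hx : ∀ k, 0 ≤ x k) :
    ∃ d : Stationary S A, ReadOff x d ∧
      ∀ i, ¬ 0 < ∑ a, x ⟨i, a⟩ → ∃ a, d i = PMF.pure a := by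
  classical
  have key : ∀ i, ∃ p : PMF (A i),
      (0 < ∑ a', x ⟨i, a'⟩ → ∀ a, (p a).toReal = x ⟨i, a⟩ / ∑ a', x ⟨i, a'⟩) ∧
      (¬ 0 < ∑ a, x ⟨i, a⟩ → ∃ a, p = PMF.pure a) := by
    intro i
    by_cases h : 0 < ∑ a', x ⟨i, a'⟩
    · have hnn : ∀ a, 0 ≤ x ⟨i, a⟩ / ∑ a', x ⟨i, a'⟩ := fun a => div_nonneg (hx _) h.le
      refine ⟨PMF.ofFintype (fun a => ENNReal.ofReal (x ⟨i, a⟩ / ∑ a', x ⟨i, a'⟩)) ?_,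
        fun _ a => ?_, fun h' => absurd h h'⟩
      · rw [← ENNReal.ofReal_sum_of_nonneg fun a _ => hnn a, ← Finset.sum_div, div_self h.ne',
          ENNReal.ofReal_one]
      · rw [PMF.ofFintype_apply, ENNReal.toReal_ofReal (hnn a)]
    · exact ⟨PMF.pure (Classical.arbitrary _), fun h' => absurd h' h, fun _ => ⟨_, rfl⟩⟩
  choose d hd using key
  exact ⟨d, fun i => (hd i).1, fun i => (hd i).2⟩

end SteadyState

/-! ### Cesàro limits of the criteria. -/

section Criteria

variable {α : ℝ} (β : ℝ) {u : Policy S A} {s : S} {x : Pairs S A → ℝ}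

theorem tendsto_average {f : ℕ → ℝ} {l : ℝ} (h : Tendsto f atTop (𝓝 l)) :
    Tendsto (fun T : ℕ => (1 / (T : ℝ)) * ∑ t ∈ Finset.range T, f t) atTop (𝓝 l) := by
  simpa only [one_div] using h.cesaro

theorem tendsto_combAvg (hα : α ∈ Set.Ioo (0 : ℝ) 1)
    (h : Tendsto (M.pairProb u s) atTop (𝓝 x)) :
    Tendsto (M.combAvg α β u s) atTop (𝓝 (M.value α β x)) := by
  refine tendsto_average ?_
  simp only [comb_eq_value _ _ hα]
  exact ((M.continuous_value α β).tendsto x).comp h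

theorem tendsto_cvarAvg (hα : α ∈ Set.Ioo (0 : ℝ) 1)
    (h : Tendsto (M.pairProb u s) atTop (𝓝 x)) :
    Tendsto (M.cvarAvg α u s) atTop (𝓝 (M.value α 0 x)) := by
  refine tendsto_average ?_
  simp only [cvar_eq_value _ hα]
  exact ((M.continuous_value α 0).tendsto x).comp h

theorem tendsto_meanAvg (h : Tendsto (M.pairProb u s) atTop (𝓝 x)) :
    Tendsto (M.meanAvg u s) atTop (𝓝 (∑ k, x k * M.r k.1 k.2)) := by
  refine tendsto_average ?_
  simp only [integral_id_rewardLaw]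
  exact tendsto_finsetSum _ fun k _ => ((tendsto_pi_nhds.1 h) k).mul_const _

variable {β}

theorem isInfOptimal_of_tendsto {V : ℝ} (hα : α ∈ Set.Ioo (0 : ℝ) 1)
    (hV : ∀ u s, M.Jsup α β u s ≤ V) (hu : ∀ s, Tendsto (M.combAvg α β u s) atTop (𝓝 V)) :
    M.IsInfOptimal α β u := fun u' s => by
  rw [Jinf_eq (hu s)]
  exact (M.Jinf_le_Jsup u' s β hα).trans (hV u' s)

end Criteria

/-! ### Saddle points by Sion's theorem. -/

section Minimax

variable {α β : ℝ}

variable {x x' : Pairs S A → ℝ} {y y' : ℝ}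

theorem IsSaddle.isLeast (h : M.IsSaddle α β x y) :
    IsLeast (M.saddleFun α β x '' M.Y) (M.saddleFun α β x y) :=
  ⟨⟨y, h.2.1, rfl⟩, by rintro _ ⟨y', hy', rfl⟩; exact h.2.2.2 y' hy'⟩

theorem IsSaddle.isGreatest (h : M.IsSaddle α β x y) :
    IsGreatest ((fun x => M.saddleFun α β x y) '' M.X) (M.saddleFun α β x y) :=
  ⟨⟨x, h.1, rfl⟩, by rintro _ ⟨x', hx', rfl⟩; exact h.2.2.1 x' hx'⟩

theorem IsSaddle.value_eq (h : M.IsSaddle α β x y) : M.value α β x = M.saddleFun α β x y :=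
  h.isLeast.csInf_eq

theorem IsSaddle.eq (h : M.IsSaddle α β x y) (h' : M.IsSaddle α β x' y') :
    M.saddleFun α β x y = M.saddleFun α β x' y' :=
  le_antisymm ((h.2.2.2 y' h'.2.1).trans (h'.2.2.1 x h.1))
    ((h'.2.2.2 y h.2.1).trans (h.2.2.1 x' h'.1))

variable [Nonempty S] [∀ i, Nonempty (A i)]

theorem exists_isSaddle (M : MDP S A) (hα : α < 1) : ∃ x y, M.IsSaddle α β x y := by
  obtain ⟨y, hy, x, hx, h⟩ := Sion.exists_isSaddlePointOn (X := M.Y) (Y := M.X)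
    (f := fun y x => M.saddleFun α β x y) M.nonempty_Y (convex_Icc _ _) M.isCompact_Y
    (fun x _ => (M.continuous_saddleFun_right α β x).lowerSemicontinuous.lowerSemicontinuousOn _)
    (fun x hx => ((M.convexOn_saddleFun β hα (M.mem_X_iff.1 hx).2.1).subset (Set.subset_univ _)
      (convex_Icc _ _)).quasiconvexOn)
    M.convex_X M.nonempty_X M.isCompact_X
    (fun y _ => (M.continuous_saddleFun_left α β y).upperSemicontinuous.upperSemicontinuousOn _)
    (fun y _ => ConcaveOn.quasiconcaveOn ⟨M.convex_X, fun x _ z _ a b _ _ _ =>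
      (M.saddleFun_combo α β x z a b y).ge⟩)
  exact ⟨x, y, hx, hy, fun x' hx' => h y hy x' hx', fun y' hy' => h y' hy' x hx⟩

theorem IsSaddle.isMaxMin (h : M.IsSaddle α β x y) : M.IsMaxMin α β (M.saddleFun α β x y) := by
  refine ⟨fun x' _ => ⟨_, M.isLeast_value α β x'⟩, ⟨x, h.1, h.isLeast⟩, ?_⟩
  rintro m ⟨x', hx', hm⟩
  exact (hm.2 ⟨y, h.2.1, rfl⟩).trans (h.2.2.1 x' hx')

theorem IsSaddle.isMinMax (h : M.IsSaddle α β x y) : M.IsMinMax α β (M.saddleFun α β x y) := by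
  refine ⟨fun y' _ => ⟨_, (M.isCompact_X.image (M.continuous_saddleFun_left α β y')).isGreatest_sSup
    (M.nonempty_X.image _)⟩, ⟨y, h.2.1, h.isGreatest⟩, ?_⟩
  rintro m ⟨y', hy', hm⟩
  exact (h.2.2.2 y' hy').trans (hm.2 ⟨x, h.1, rfl⟩)

end Minimax

end MDP

namespace MDP

variable {S : Type*} {A : S → Type*} [Fintype S] [∀ i, Fintype (A i)] {M : MDP S A}

/-! ### Feasible directions and vertices of the polytope. -/

section Perturbation

theorem exists_pos_mul_abs_le {ι : Type*} [Finite ι] {x z : ι → ℝ} (hx : ∀ k, 0 ≤ x k)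
    (hz : ∀ k, x k = 0 → z k = 0) : ∃ ε > 0, ∀ k, ε * |z k| ≤ x k := by
  have h : ∀ k, ∀ᶠ ε in 𝓝[>] (0 : ℝ), ε * |z k| ≤ x k := by
    intro k
    rcases (hx k).eq_or_lt with h0 | h0
    · simp [hz k h0.symm, ← h0]
    · have hc : Tendsto (fun ε : ℝ => ε * |z k|) (𝓝[>] 0) (𝓝 (0 * |z k|)) :=
        (tendsto_id.mul_const _).mono_left nhdsWithin_le_nhds
      rw [zero_mul] at hc
      exact (hc.eventually (eventually_lt_nhds h0)).mono fun _ h => h.le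
  obtain ⟨ε, h1, h2⟩ := ((eventually_all.2 h).and self_mem_nhdsWithin).exists
  exact ⟨ε, h2, h1⟩

/-- One can move from a point of the polytope in both directions along a balanced vector that is
supported by the point. -/
theorem exists_perturbation_mem_X {x z : Pairs S A → ℝ} (hx : x ∈ M.X)
    (hz : ∀ k, x k = 0 → z k = 0) (hbal : ∀ j, M.balance j z = 0) (hsum : ∑ k, z k = 0) :
    ∃ ε > (0 : ℝ), x + ε • z ∈ M.X ∧ x + (-ε) • z ∈ M.X := by
  have hX := M.mem_X_iff.1 hx
  obtain ⟨ε, hε, h⟩ := exists_pos_mul_abs_le hX.2.1 hz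
  have key : ∀ c : ℝ, |c| = ε → x + c • z ∈ M.X := by
    intro c hc
    refine M.mem_X_iff.2 ⟨fun j => ?_, fun k => ?_, ?_⟩
    · rw [balance_add_smul, hX.1, hbal, mul_zero, add_zero]
    · have h1 := h k
      rw [← hc, ← abs_mul] at h1
      have h2 := (abs_le.1 h1).1
      simp only [Pi.add_apply, Pi.smul_apply, smul_eq_mul]
      linarith
    · simp [Finset.sum_add_distrib, ← Finset.mul_sum, hsum, hX.2.2]
  exact ⟨ε, hε, key ε (abs_of_pos hε), key (-ε) (by rw [abs_neg, abs_of_pos hε])⟩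

theorem mem_openSegment_perturbation {ι : Type*} (x z : ι → ℝ) (ε : ℝ) :
    x ∈ openSegment ℝ (x + ε • z) (x + (-ε) • z) := by
  refine ⟨1 / 2, 1 / 2, by norm_num, by norm_num, by norm_num, ?_⟩
  funext k
  simp only [Pi.add_apply, Pi.smul_apply, smul_eq_mul]
  ring

/-- A vertex is determined by its zero set: the difference of two vertices with equal zero sets is a
feasible direction both ways, hence zero. Finiteness of the vertex set follows. -/
theorem extremePoints_X_injOn :
    Set.InjOn (fun x : Pairs S A → ℝ => {k | x k = 0}) (Set.extremePoints ℝ M.X) := by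
  intro x hx x' hx' hsupp
  have hX := M.mem_X_iff.1 hx.1
  have hX' := M.mem_X_iff.1 hx'.1
  have hiff : ∀ k, x k = 0 ↔ x' k = 0 := fun k => Set.ext_iff.1 hsupp k
  obtain ⟨ε, hε, h1, h2⟩ := exists_perturbation_mem_X hx.1 (z := x' + (-1 : ℝ) • x)
    (fun k hk => by simp [hk, (hiff k).1 hk])
    (fun j => by rw [balance_add_smul, hX.1, hX'.1]; simp)
    (by simp [Finset.sum_add_distrib, hX.2.2, hX'.2.2])
  have h3 := hx.2 h1 h2 (mem_openSegment_perturbation _ _ _)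
  funext k
  have h4 := congrFun h3 k
  simp only [Pi.add_apply, Pi.smul_apply, smul_eq_mul] at h4
  have h5 : ε * (x' k + -1 * x k) = 0 := by linarith
  rcases mul_eq_zero.1 h5 with h | h
  · exact absurd h hε.ne'
  · linarith

theorem finite_extremePoints_X (M : MDP S A) : (Set.extremePoints ℝ M.X).Finite :=
  Set.Finite.of_finite_image (Set.toFinite _) extremePoints_X_injOn

theorem le_of_forall_extremePoints (c : Pairs S A → ℝ) {b : ℝ}
    (h : ∀ x ∈ Set.extremePoints ℝ M.X, ∑ k, x k * c k ≤ b) {x : Pairs S A → ℝ} (hx : x ∈ M.X) :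
    ∑ k, x k * c k ≤ b := by
  rw [← closure_convexHull_extremePoints M.isCompact_X M.convex_X] at hx
  have hclosed : IsClosed {x : Pairs S A → ℝ | ∑ k, x k * c k ≤ b} :=
    isClosed_le (by fun_prop) continuous_const
  refine closure_minimal (convexHull_min h ?_) hclosed hx
  refine convex_halfSpace_le (f := fun x : Pairs S A → ℝ => ∑ k, x k * c k) ⟨fun x z => ?_, fun a x => ?_⟩ b
  · simp [add_mul, Finset.sum_add_distrib]
  · simp [Finset.mul_sum, mul_assoc]

end Perturbation

/-! ### Counting supports and randomizations. -/

section Support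

/-- One balance equation is redundant; in `exists_direction` its place is taken by the
normalization. -/
theorem sum_balance (M : MDP S A) (z : Pairs S A → ℝ) : ∑ j, M.balance j z = 0 := by
  simp only [balance, Finset.sum_sub_distrib]
  rw [Finset.sum_comm, ← Fintype.sum_sigma (f := z), sub_eq_zero]
  refine Finset.sum_congr rfl fun k _ => ?_
  rw [← Finset.sum_mul, sum_toReal, one_mul]

/-- A state without mass has no inflow from the support of `x`, so its balance equation costs
nothing in the dimension count. -/
theorem balance_eq_zero_of_marginal_eq_zero {x z : Pairs S A → ℝ} (hx : x ∈ M.X)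
    (hz : ∀ k, x k = 0 → z k = 0) {j : S} (hj : ¬ 0 < ∑ a, x ⟨j, a⟩) : M.balance j z = 0 := by
  have hX := M.mem_X_iff.1 hx
  have hsum : ∑ a, x ⟨j, a⟩ = 0 := le_antisymm (not_lt.1 hj) (Finset.sum_nonneg fun a _ => hX.2.1 _)
  have h0 := hX.1 j
  rw [balance, hsum, zero_sub, neg_eq_zero,
    Finset.sum_eq_zero_iff_of_nonneg fun k _ => mul_nonneg ENNReal.toReal_nonneg (hX.2.1 k)] at h0
  rw [Finset.sum_eq_zero_iff_of_nonneg fun a _ => hX.2.1 _] at hsum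
  rw [balance, Finset.sum_eq_zero fun a ha => hz _ (hsum a ha), zero_sub, neg_eq_zero]
  refine Finset.sum_eq_zero fun k hk => ?_
  rcases mul_eq_zero.1 (h0 k hk) with h | h
  · rw [h, zero_mul]
  · rw [hz k h, mul_zero]

/-- Too many positive coordinates leave a balanced direction on which `g` vanishes. -/
theorem exists_direction {x : Pairs S A → ℝ} (hx : x ∈ M.X) (g : Pairs S A → ℝ)
    (hcard : Nat.card {j : S // 0 < ∑ a, x ⟨j, a⟩} + 1 < Nat.card {k // 0 < x k}) :
    ∃ z : Pairs S A → ℝ, z ≠ 0 ∧ (∀ k, x k = 0 → z k = 0) ∧ (∀ j, M.balance j z = 0) ∧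
      ∑ k, z k = 0 ∧ ∑ k, z k * g k = 0 := by
  classical
  have hX := M.mem_X_iff.1 hx
  obtain ⟨j₀, hj₀⟩ : ∃ j : S, 0 < ∑ a, x ⟨j, a⟩ := by
    by_contra! hcon
    have h1 := hX.2.2
    rw [Fintype.sum_sigma] at h1
    have h2 := Finset.sum_nonpos fun j (_ : j ∈ Finset.univ) => hcon j
    linarith
  -- The constraints on `z` are: vanishing off the support of `x`, the `g`-equation (`none`), and
  -- one equation per charged state, where `j₀` carries total mass zero instead of its redundant
  -- balance equation. By `hcard` they are fewer than the pairs.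
  let ι := {k // ¬ 0 < x k} ⊕ Option {j : S // 0 < ∑ a, x ⟨j, a⟩}
  let φ : (Pairs S A → ℝ) → ι → ℝ := fun z =>
    Sum.elim (fun k => z k) (fun o => o.elim (∑ k, z k * g k)
      fun j => if j.1 = j₀ then ∑ k, z k else M.balance j z)
  have hadd : ∀ z z', φ (z + z') = φ z + φ z' := by
    intro z z'
    funext i
    rcases i with k | _ | j
    · rfl
    · simp [φ, add_mul, Finset.sum_add_distrib]
    · have := M.balance_add_smul j.1 z z' 1
      rw [one_smul, one_mul] at this
      simp only [φ, Sum.elim_inr, Option.elim_some, Pi.add_apply, this]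
      split_ifs <;> simp [Finset.sum_add_distrib]
  have hsmul : ∀ (c : ℝ) z, φ (c • z) = c • φ z := by
    intro c z
    funext i
    rcases i with k | _ | j
    · rfl
    · simp [φ, Finset.mul_sum, mul_assoc]
    · have := M.balance_add_smul j.1 0 z c
      have h0 : M.balance j.1 0 = 0 := by simp [balance]
      rw [zero_add, h0, zero_add] at this
      simp only [φ, Sum.elim_inr, Option.elim_some, Pi.smul_apply, this]
      split_ifs <;> simp [Finset.mul_sum]
  let f : (Pairs S A → ℝ) →ₗ[ℝ] ι → ℝ := { toFun := φ, map_add' := hadd, map_smul' := hsmul }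
  have hlt : Module.finrank ℝ (ι → ℝ) < Module.finrank ℝ (Pairs S A → ℝ) := by
    rw [Module.finrank_fintype_fun_eq_card, Module.finrank_fintype_fun_eq_card]
    have h1 := Fintype.card_subtype_compl fun k : Pairs S A => 0 < x k
    have h2 := Fintype.card_subtype_le fun k : Pairs S A => 0 < x k
    rw [Nat.card_eq_fintype_card, Nat.card_eq_fintype_card] at hcard
    simp only [ι, Fintype.card_sum, Fintype.card_option]
    omega
  obtain ⟨z, hz, hz0⟩ := (Submodule.ne_bot_iff _).1 (LinearMap.ker_ne_bot_of_finrank_lt (f := f) hlt)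
  have hz' : ∀ i, φ z i = 0 := fun i => congrFun (LinearMap.mem_ker.1 hz) i
  have hsupp : ∀ k, x k = 0 → z k = 0 := fun k hk => hz' (Sum.inl ⟨k, by simp [hk]⟩)
  have hbal : ∀ j, j ≠ j₀ → M.balance j z = 0 := by
    intro j hj
    by_cases hpos : 0 < ∑ a, x ⟨j, a⟩
    · simpa [φ, hj] using hz' (Sum.inr (some ⟨j, hpos⟩))
    · exact balance_eq_zero_of_marginal_eq_zero hx hsupp hpos
  refine ⟨z, hz0, hsupp, fun j => ?_, ?_, hz' (Sum.inr none)⟩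
  · rcases eq_or_ne j j₀ with rfl | hj
    · rw [← M.sum_balance z]
      exact (Finset.sum_eq_single j (fun i _ hi => hbal i hi) (by simp)).symm
    · exact hbal j hj
  · simpa [φ] using hz' (Sum.inr (some ⟨j₀, hj₀⟩))

/-- The identity holds state by state. A charged state has a positive action, so the truncated
subtraction is exact; at an uncharged one both sides vanish, the choice there being pure. -/
theorem numRandomizations_add {x : Pairs S A → ℝ} (hx : ∀ k, 0 ≤ x k) {d : Stationary S A}
    (hd : ReadOff x d) (hpure : ∀ i, ¬ 0 < ∑ a, x ⟨i, a⟩ → ∃ a, d i = PMF.pure a) :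
    d.numRandomizations + Nat.card {j : S // 0 < ∑ a, x ⟨j, a⟩} = Nat.card {k // 0 < x k} := by
  classical
  have h1 : Nat.card {k // 0 < x k} = ∑ i, Set.ncard {a : A i | 0 < x ⟨i, a⟩} := by
    let e : {k // 0 < x k} ≃ Σ i, {a : A i // 0 < x ⟨i, a⟩} :=
      { toFun := fun k => ⟨k.1.1, k.1.2, k.2⟩
        invFun := fun k => ⟨⟨k.1, k.2.1⟩, k.2.2⟩
        left_inv := fun _ => rfl
        right_inv := fun _ => rfl }
    rw [Nat.card_congr e, Nat.card_sigma]
    rfl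
  have h2 : Nat.card {j : S // 0 < ∑ a, x ⟨j, a⟩} = ∑ j, if 0 < ∑ a, x ⟨j, a⟩ then 1 else 0 := by
    rw [Nat.card_eq_fintype_card, Fintype.card_subtype, Finset.card_filter]
  rw [h1, h2, Stationary.numRandomizations, ← Finset.sum_add_distrib]
  refine Finset.sum_congr rfl fun i _ => ?_
  by_cases hi : 0 < ∑ a, x ⟨i, a⟩
  · have hset : {a : A i | 0 < d i a} = {a : A i | 0 < x ⟨i, a⟩} := by
      ext a
      have h3 := ReadOff.eq_mul hx hd i a
      have h4 : 0 < d i a ↔ 0 < (d i a).toReal := by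
        rw [ENNReal.toReal_pos_iff]
        exact ⟨fun h => ⟨h, (PMF.apply_ne_top _ _).lt_top⟩, fun h => h.1⟩
      simp only [Set.mem_ofPred_eq]
      rw [h4, h3, mul_pos_iff_of_pos_left hi]
    have hne : 0 < Set.ncard {a : A i | 0 < x ⟨i, a⟩} := by
      rw [Set.ncard_pos]
      by_contra hcon
      rw [Set.not_nonempty_iff_eq_empty, Set.eq_empty_iff_forall_notMem] at hcon
      exact hi.not_ge (Finset.sum_nonpos fun a _ => not_lt.1 (hcon a))
    rw [hset, if_pos hi]
    omega
  · have h3 : {a : A i | 0 < x ⟨i, a⟩} = ∅ := by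
      rw [Set.eq_empty_iff_forall_notMem]
      intro a ha
      exact hi (Finset.sum_pos' (fun b _ => hx _) ⟨a, Finset.mem_univ _, ha⟩)
    obtain ⟨a, ha⟩ := hpure i hi
    have h4 : {b : A i | 0 < d i b} = {a} := by
      ext b
      simp [ha, PMF.pure_apply, pos_iff_ne_zero]
    rw [h3, h4, if_neg hi, Set.ncard_singleton, Set.ncard_empty]

end Support

end MDP

namespace MDP

variable {S : Type*} {A : S → Type*} [Fintype S] [∀ i, Fintype (A i)] {M : MDP S A}
  {α β : ℝ} {x : Pairs S A → ℝ} {y : ℝ}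

/-! ### Optimality conditions at a saddle point and sparse saddle points. -/

section Optimality

theorem r_mem_Y (M : MDP S A) (k : Pairs S A) : M.r k.1 k.2 ∈ M.Y := ⟨M.iInf_r_le k, M.le_iSup_r k⟩

/-- First-order condition to the right of the saddle point. -/
theorem IsSaddle.sum_lt_le (hα : α < 1) (h : M.IsSaddle α β x y) :
    ∑ k, x k * (if y < M.r k.1 k.2 then 1 else 0) ≤ 1 - α := by
  have h0 : 0 < 1 - α := by linarith
  have hx := (M.mem_X_iff.1 h.1).2
  rcases (Finset.univ.filter fun k : Pairs S A => y < M.r k.1 k.2).eq_empty_or_nonempty with he | hne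
  · rw [Finset.filter_eq_empty_iff] at he
    rw [Finset.sum_eq_zero fun k hk => by rw [if_neg (he hk), mul_zero]]
    exact h0.le
  · obtain ⟨k₀, hk₀, hmin⟩ := Finset.exists_min_image _ (fun k : Pairs S A => M.r k.1 k.2) hne
    simp only [Finset.mem_filter, Finset.mem_univ, true_and] at hk₀ hmin
    have h1 := h.2.2.2 _ (M.r_mem_Y k₀)
    rw [saddleFun_eq _ hx.2, saddleFun_eq _ hx.2] at h1
    set y' := M.r k₀.1 k₀.2
    have h2 : ∑ k, x k * max (M.r k.1 k.2 - y) 0 = ∑ k, x k * max (M.r k.1 k.2 - y') 0 +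
        (y' - y) * ∑ k, x k * (if y < M.r k.1 k.2 then 1 else 0) := by
      rw [Finset.mul_sum, ← Finset.sum_add_distrib]
      refine Finset.sum_congr rfl fun k _ => ?_
      by_cases hk : y < M.r k.1 k.2
      · have := hmin k hk
        rw [if_pos hk, max_eq_left (by linarith), max_eq_left (by linarith)]
        ring
      · rw [if_neg hk, max_eq_right (by linarith), max_eq_right (by linarith)]
        ring
    rw [h2] at h1
    set p := ∑ k, x k * (if y < M.r k.1 k.2 then (1 : ℝ) else 0)
    have h3 : (1 / (1 - α)) * ((y' - y) * p) ≤ y' - y := by linarith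
    rw [one_div, inv_mul_le_iff₀ h0, mul_comm (1 - α)] at h3
    exact le_of_mul_le_mul_left h3 (by linarith)

/-- First-order condition to the left of the saddle point. -/
theorem IsSaddle.le_sum_le (hα : α ∈ Set.Ioo (0 : ℝ) 1) (h : M.IsSaddle α β x y) :
    1 - α ≤ ∑ k, x k * (if y ≤ M.r k.1 k.2 then 1 else 0) := by
  have h0 : 0 < 1 - α := by linarith [hα.2]
  have hx := (M.mem_X_iff.1 h.1).2
  rcases (Finset.univ.filter fun k : Pairs S A => M.r k.1 k.2 < y).eq_empty_or_nonempty with he | hne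
  · rw [Finset.filter_eq_empty_iff] at he
    rw [Finset.sum_congr rfl fun k hk => by rw [if_pos (not_lt.1 (he hk)), mul_one], hx.2]
    linarith [hα.1]
  · obtain ⟨k₀, hk₀, hmax⟩ := Finset.exists_max_image _ (fun k : Pairs S A => M.r k.1 k.2) hne
    simp only [Finset.mem_filter, Finset.mem_univ, true_and] at hk₀ hmax
    have h1 := h.2.2.2 _ (M.r_mem_Y k₀)
    rw [saddleFun_eq _ hx.2, saddleFun_eq _ hx.2] at h1
    set y' := M.r k₀.1 k₀.2
    have h2 : ∑ k, x k * max (M.r k.1 k.2 - y') 0 = ∑ k, x k * max (M.r k.1 k.2 - y) 0 +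
        (y - y') * ∑ k, x k * (if y ≤ M.r k.1 k.2 then 1 else 0) := by
      rw [Finset.mul_sum, ← Finset.sum_add_distrib]
      refine Finset.sum_congr rfl fun k _ => ?_
      by_cases hk : y ≤ M.r k.1 k.2
      · rw [if_pos hk, max_eq_left (by linarith), max_eq_left (by linarith)]
        ring
      · have := hmax k (not_le.1 hk)
        rw [if_neg hk, max_eq_right (by linarith), max_eq_right (by linarith)]
        ring
    rw [h2] at h1
    set p := ∑ k, x k * (if y ≤ M.r k.1 k.2 then (1 : ℝ) else 0)
    have h3 : y - y' ≤ (1 / (1 - α)) * ((y - y') * p) := by linarith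
    rw [one_div, le_inv_mul_iff₀ h0, mul_comm (1 - α)] at h3
    exact le_of_mul_le_mul_left h3 (by linarith)

/-- At a saddle point the excess functions have subgradients whose `x`-mean is `1 - α`. -/
theorem IsSaddle.exists_subgradient (hα : α ∈ Set.Ioo (0 : ℝ) 1) (h : M.IsSaddle α β x y) :
    ∃ g : Pairs S A → ℝ,
      (∀ k y', max (M.r k.1 k.2 - y) 0 - g k * (y' - y) ≤ max (M.r k.1 k.2 - y') 0) ∧
      ∑ k, x k * g k = 1 - α := by
  have h1 := h.sum_lt_le hα.2
  have h2 := h.le_sum_le hα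
  set a := ∑ k, x k * (if y < M.r k.1 k.2 then (1 : ℝ) else 0)
  set b := ∑ k, x k * (if y ≤ M.r k.1 k.2 then (1 : ℝ) else 0)
  -- The first-order conditions put `1 - α` between the masses of `{r > y}` and `{r ≥ y}`; `l`
  -- interpolates the two indicators.
  obtain ⟨l, hl0, hl1, hl⟩ : ∃ l : ℝ, 0 ≤ l ∧ l ≤ 1 ∧ (1 - l) * a + l * b = 1 - α := by
    rcases (h1.trans h2).eq_or_lt with hab | hab
    · exact ⟨0, le_rfl, zero_le_one, by linarith⟩
    · have hd : 0 < b - a := sub_pos.2 hab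
      refine ⟨(1 - α - a) / (b - a), div_nonneg (by linarith) hd.le,
        (div_le_one hd).2 (by linarith), ?_⟩
      field_simp
      ring
  refine ⟨fun k => (1 - l) * (if y < M.r k.1 k.2 then 1 else 0) +
    l * (if y ≤ M.r k.1 k.2 then 1 else 0), fun k y' => ?_, ?_⟩
  · dsimp only
    rcases lt_trichotomy y (M.r k.1 k.2) with hk | hk | hk
    · rw [if_pos hk, if_pos hk.le, max_eq_left (by linarith)]
      exact le_max_of_le_left (by linarith)
    · rw [if_neg hk.not_lt, if_pos hk.le, max_eq_left (by linarith), ← hk]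
      rcases le_total y y' with h' | h'
      · exact le_max_of_le_right (by nlinarith)
      · exact le_max_of_le_left (by nlinarith)
    · rw [if_neg hk.not_gt, if_neg hk.not_ge, max_eq_right (by linarith)]
      exact le_max_of_le_right (by linarith)
  · rw [← hl, Finset.mul_sum, Finset.mul_sum, ← Finset.sum_add_distrib]
    exact Finset.sum_congr rfl fun k _ => by ring

/-- Averaging the subgradient inequalities over `x` gives slope `-(1 - α)`; divided by `1 - α` it
cancels the slope of the term `y`. So a single linear equation keeps `y` minimizing. -/
theorem isSaddle_of_subgradient (hα : α < 1) {x' : Pairs S A → ℝ} (h : M.IsSaddle α β x' y)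
    {g : Pairs S A → ℝ}
    (hg : ∀ k y', max (M.r k.1 k.2 - y) 0 - g k * (y' - y) ≤ max (M.r k.1 k.2 - y') 0)
    (hx : x ∈ M.X) (hval : M.saddleFun α β x y = M.saddleFun α β x' y)
    (hmean : ∑ k, x k * g k = 1 - α) : M.IsSaddle α β x y := by
  have h0 : 0 < 1 - α := by linarith
  have hX := (M.mem_X_iff.1 hx).2
  refine ⟨hx, h.2.1, fun z hz => hval ▸ h.2.2.1 z hz, fun y' _ => ?_⟩
  rw [saddleFun_eq _ hX.2, saddleFun_eq _ hX.2]
  have h1 : ∑ k, x k * max (M.r k.1 k.2 - y) 0 - (1 - α) * (y' - y) ≤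
      ∑ k, x k * max (M.r k.1 k.2 - y') 0 := by
    rw [← hmean, Finset.sum_mul, ← Finset.sum_sub_distrib]
    refine Finset.sum_le_sum fun k _ => ?_
    have := mul_le_mul_of_nonneg_left (hg k y') (hX.1 k)
    linarith
  have h2 := mul_le_mul_of_nonneg_left h1 (one_div_pos.2 h0).le
  rw [mul_sub, ← mul_assoc, one_div_mul_cancel h0.ne', one_mul] at h2
  linarith

/-- There is a saddle point whose support has at most one more element than the set of states
that it charges. -/
theorem exists_isSaddle_card_le [Nonempty S] [∀ i, Nonempty (A i)] (M : MDP S A)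
    (hα : α ∈ Set.Ioo (0 : ℝ) 1) : ∃ x y, M.IsSaddle α β x y ∧
      Nat.card {k // 0 < x k} ≤ Nat.card {j : S // 0 < ∑ a, x ⟨j, a⟩} + 1 := by
  obtain ⟨x₀, y, h⟩ := M.exists_isSaddle (β := β) hα.2
  obtain ⟨g, hg, hmean⟩ := h.exists_subgradient hα
  let F : Set (Pairs S A → ℝ) := M.X ∩ {x | M.saddleFun α β x y = M.saddleFun α β x₀ y} ∩
    {x | ∑ k, x k * g k = 1 - α}
  have hF : IsCompact F := (M.isCompact_X.inter_right (isClosed_eq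
    (M.continuous_saddleFun_left α β y) continuous_const)).inter_right
    (isClosed_eq (by fun_prop) continuous_const)
  obtain ⟨x, hx⟩ := hF.extremePoints_nonempty ⟨x₀, ⟨h.1, rfl⟩, hmean⟩
  refine ⟨x, y, isSaddle_of_subgradient hα.2 h hg hx.1.1.1 hx.1.1.2 hx.1.2, ?_⟩
  by_contra! hcard
  obtain ⟨z, hz0, hsupp, hbal, hsum, hgz⟩ := exists_direction hx.1.1.1 g hcard
  obtain ⟨ε, hε, h1, h2⟩ := exists_perturbation_mem_X hx.1.1.1 hsupp hbal hsum
  have hlin : ∀ c : ℝ, M.saddleFun α β (x + c • z) y =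
      M.saddleFun α β x₀ y + c * M.saddleFun α β z y := by
    intro c
    have := M.saddleFun_combo α β x z 1 c y
    rw [one_smul, one_mul] at this
    rw [this, hx.1.1.2]
  -- Since `x` maximizes the saddle function at `y`, it is constant along a two-sided feasible
  -- direction; fixing the value thus adds no equation to the count.
  have hle1 := h.2.2.1 _ h1
  have hle2 := h.2.2.1 _ h2
  rw [hlin] at hle1 hle2
  have hzero : M.saddleFun α β z y = 0 := by
    have h3 : ε * M.saddleFun α β z y = 0 := by linarith
    exact (mul_eq_zero.1 h3).resolve_left hε.ne'
  have hmem : ∀ c : ℝ, x + c • z ∈ M.X → x + c • z ∈ F := by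
    intro c hc
    refine ⟨⟨hc, ?_⟩, ?_⟩
    · rw [Set.mem_ofPred_eq, hlin, hzero, mul_zero, add_zero]
    · have h4 : ∑ k, (x + c • z) k * g k = ∑ k, x k * g k + c * ∑ k, z k * g k := by
        simp [add_mul, Finset.sum_add_distrib, Finset.mul_sum, mul_assoc]
      rw [Set.mem_ofPred_eq, h4, hgz, mul_zero, add_zero]
      exact hx.1.2
  have heq := hx.2 (hmem _ h1) (hmem _ h2) (mem_openSegment_perturbation x z ε)
  refine hz0 (funext fun k => ?_)
  have h5 := congrFun heq k
  simp only [Pi.add_apply, Pi.smul_apply, smul_eq_mul, add_eq_left] at h5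
  exact (mul_eq_zero.1 h5).resolve_left hε.ne'

end Optimality

/-! ### The two linear programs. -/

section LinearPrograms

/-- The saddle function is affine in `y` between consecutive rewards, so that its minimum is attained
at a reward. -/
theorem le_saddleFun_of_forall [Nonempty S] [∀ i, Nonempty (A i)] {z : ℝ} (hy : y ∈ M.Y)
    (h : ∀ l : Pairs S A, z ≤ M.saddleFun α β x (M.r l.1 l.2)) : z ≤ M.saddleFun α β x y := by
  have : Nonempty (Pairs S A) := ⟨⟨Classical.arbitrary S, Classical.arbitrary _⟩⟩
  obtain ⟨m₁, hm₁⟩ := exists_eq_ciInf_of_finite (f := fun k : Pairs S A => M.r k.1 k.2)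
  obtain ⟨m₂, hm₂⟩ := exists_eq_ciSup_of_finite (f := fun k : Pairs S A => M.r k.1 k.2)
  obtain ⟨l₁, hl₁, hmax⟩ := Finset.exists_max_image
    (Finset.univ.filter fun k : Pairs S A => M.r k.1 k.2 ≤ y) (fun k => M.r k.1 k.2)
    ⟨m₁, by simpa using hm₁.trans_le hy.1⟩
  obtain ⟨l₂, hl₂, hmin⟩ := Finset.exists_min_image
    (Finset.univ.filter fun k : Pairs S A => y ≤ M.r k.1 k.2) (fun k => M.r k.1 k.2)
    ⟨m₂, by simpa using hy.2.trans_eq hm₂.symm⟩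
  simp only [Finset.mem_filter, Finset.mem_univ, true_and] at hl₁ hmax hl₂ hmin
  have h1 := h l₁
  have h2 := h l₂
  set a := M.r l₁.1 l₁.2
  set b := M.r l₂.1 l₂.2
  rcases (hl₁.trans hl₂).eq_or_lt with hab | hab
  · rwa [le_antisymm hl₁ (hab ▸ hl₂)] at h1
  · have key : (b - a) * M.saddleFun α β x y =
        (b - y) * M.saddleFun α β x a + (y - a) * M.saddleFun α β x b := by
      simp only [saddleFun, Finset.mul_sum, ← Finset.sum_add_distrib]
      refine Finset.sum_congr rfl fun k _ => ?_
      rcases le_total (M.r k.1 k.2) y with hk | hk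
      · have := hmax k hk
        rw [max_eq_right (by linarith), max_eq_right (by linarith), max_eq_right (by linarith)]
        ring
      · have := hmin k hk
        rw [max_eq_left (by linarith), max_eq_left (by linarith), max_eq_left (by linarith)]
        ring
    have h3 := mul_le_mul_of_nonneg_left h1 (sub_nonneg.2 hl₂)
    have h4 := mul_le_mul_of_nonneg_left h2 (sub_nonneg.2 hl₁)
    refine le_of_mul_le_mul_left ?_ (sub_pos.2 hab)
    rw [key]
    linarith

theorem dualFeasible_iff [Nonempty S] [∀ i, Nonempty (A i)] {z : ℝ} :
    M.DualFeasible α β x z ↔ x ∈ M.X ∧ ∀ y ∈ M.Y, z ≤ M.saddleFun α β x y := by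
  constructor
  · rintro ⟨h1, h2, h3⟩
    exact ⟨⟨fun j => sub_eq_zero.1 (h2 j), h3⟩, fun y hy => le_saddleFun_of_forall hy h1⟩
  · rintro ⟨h1, h2⟩
    exact ⟨fun l => h2 _ (M.r_mem_Y l), fun j => sub_eq_zero.2 (h1.1 j), h1.2⟩

theorem PrimalFeasible.saddleFun_le (hα : α < 1) {z : ℝ} {w : Pairs S A → ℝ}
    (h : M.PrimalFeasible α β y z w) (hx : x ∈ M.X) : M.saddleFun α β x y ≤ z := by
  have h0 : 0 < 1 - α := by linarith
  refine le_trans (Finset.sum_le_sum fun k _ => ?_) (le_of_forall_extremePoints _ h.1 hx)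
  have h1 := mul_le_mul_of_nonneg_left (max_le (h.2.1 k) (h.2.2.1 k)) (one_div_pos.2 h0).le
  exact mul_le_mul_of_nonneg_left (by linarith) ((M.mem_X_iff.1 hx).2.1 k)

theorem primalFeasible_of_forall {z : ℝ} (hy : y ∈ M.Y)
    (h : ∀ x ∈ M.X, M.saddleFun α β x y ≤ z) :
    M.PrimalFeasible α β y z fun k => max (M.r k.1 k.2 - y) 0 :=
  ⟨fun x hx => h x hx.1, fun _ => le_max_left _ _, fun _ => le_max_right _ _, hy.1, hy.2⟩

variable {x₀ : Pairs S A → ℝ} {y₀ : ℝ} (h : M.IsSaddle α β x₀ y₀)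
include h

theorem IsSaddle.le_of_primalFeasible (hα : α < 1) {z : ℝ} {w : Pairs S A → ℝ}
    (hf : M.PrimalFeasible α β y z w) : M.saddleFun α β x₀ y₀ ≤ z :=
  (h.2.2.2 y ⟨hf.2.2.2.1, hf.2.2.2.2⟩).trans (hf.saddleFun_le hα h.1)

theorem IsSaddle.primalOptimal (hα : α < 1) :
    M.PrimalOptimal α β y₀ (M.saddleFun α β x₀ y₀) fun k => max (M.r k.1 k.2 - y₀) 0 :=
  ⟨primalFeasible_of_forall h.2.1 h.2.2.1, fun _ _ _ hf => h.le_of_primalFeasible hα hf⟩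

variable [Nonempty S] [∀ i, Nonempty (A i)]

theorem IsSaddle.dualOptimal : M.DualOptimal α β x₀ (M.saddleFun α β x₀ y₀) := by
  refine ⟨dualFeasible_iff.2 ⟨h.1, h.2.2.2⟩, fun x z hf => ?_⟩
  rw [dualFeasible_iff] at hf
  exact (hf.2 _ h.2.1).trans (h.2.2.1 _ hf.1)

/-- Optimal solutions of the two programs form a saddle point. -/
theorem IsSaddle.of_optimal (hα : α < 1) {z₁ z₂ : ℝ} {w : Pairs S A → ℝ}
    (h₁ : M.PrimalOptimal α β y z₁ w) (h₂ : M.DualOptimal α β x z₂) :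
    M.IsSaddle α β x y ∧ z₁ = M.saddleFun α β x₀ y₀ ∧ z₂ = M.saddleFun α β x₀ y₀ := by
  have hz₁ : z₁ = M.saddleFun α β x₀ y₀ :=
    le_antisymm (h₁.2 _ _ _ (h.primalOptimal hα).1) (h.le_of_primalFeasible hα h₁.1)
  have hz₂ : z₂ = M.saddleFun α β x₀ y₀ :=
    le_antisymm (h.dualOptimal.2 _ _ h₂.1) (h₂.2 _ _ h.dualOptimal.1)
  have hf := dualFeasible_iff.1 h₂.1
  have hy : y ∈ M.Y := ⟨h₁.1.2.2.2.1, h₁.1.2.2.2.2⟩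
  have hle : ∀ x ∈ M.X, M.saddleFun α β x y ≤ z₁ := fun x hx => h₁.1.saddleFun_le hα hx
  -- The value is squeezed between the two optimal values, which coincide.
  have heq : M.saddleFun α β x y = M.saddleFun α β x₀ y₀ :=
    le_antisymm (hz₁ ▸ hle x hf.1) (hz₂ ▸ hf.2 y hy)
  refine ⟨⟨hf.1, hy, fun x' hx' => ?_, fun y' hy' => ?_⟩, hz₁, hz₂⟩
  · rw [heq, ← hz₁]; exact hle x' hx'
  · rw [heq, ← hz₂]; exact hf.2 y' hy'

end LinearPrograms

/-! ### Optimal policies from saddle points. -/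

section Synthesis

theorem IsSaddle.Jsup_le [Nonempty S] [∀ i, Nonempty (A i)] (hα : α ∈ Set.Ioo (0 : ℝ) 1)
    (h : M.IsSaddle α β x y) (u : Policy S A) (s : S) :
    M.Jsup α β u s ≤ M.saddleFun α β x y :=
  MDP.Jsup_le M u s β hα h.2.1 h.2.2.1

variable [DecidableEq S]

/-- Policies read off from a saddle point attain the saddle value. -/
theorem IsSaddle.tendsto_combAvg (hM : M.UnichainAperiodic) (hα : α ∈ Set.Ioo (0 : ℝ) 1)
    (h : M.IsSaddle α β x y) {d : Stationary S A} (hd : ReadOff x d) (s : S) :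
    Tendsto (M.combAvg α β d.toPolicy s) atTop (𝓝 (M.saddleFun α β x y)) := by
  rw [← h.value_eq]
  exact MDP.tendsto_combAvg β hα (tendsto_pairProb_of_readOff hM h.1 hd s)

variable [Nonempty S] [∀ i, Nonempty (A i)]

theorem IsSaddle.optimal (hM : M.UnichainAperiodic) (hα : α ∈ Set.Ioo (0 : ℝ) 1)
    (h : M.IsSaddle α β x y) {d : Stationary S A} (hd : ReadOff x d) :
    M.IsOptimal α β d.toPolicy ∧ M.IsSupOptimal α β d.toPolicy ∧ M.IsInfOptimal α β d.toPolicy :=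
  ⟨isOptimal_of_tendsto (h.Jsup_le hα) (h.tendsto_combAvg hM hα hd),
    isSupOptimal_of_tendsto (h.Jsup_le hα) (h.tendsto_combAvg hM hα hd),
    isInfOptimal_of_tendsto hα (h.Jsup_le hα) (h.tendsto_combAvg hM hα hd)⟩

theorem IsSaddle.isGreatest_criteria (hM : M.UnichainAperiodic) (hα : α ∈ Set.Ioo (0 : ℝ) 1)
    (h : M.IsSaddle α β x y) (s : S) :
    IsGreatest ((fun u => M.J α β u s) '' {u | M.WellDefined α β u}) (M.saddleFun α β x y) ∧
    IsGreatest (Set.range fun u : Policy S A => M.Jsup α β u s) (M.saddleFun α β x y) ∧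
    IsGreatest (Set.range fun u : Policy S A => M.Jinf α β u s) (M.saddleFun α β x y) ∧
    IsGreatest (Set.range fun d : Stationary S A => M.J α β d.toPolicy s)
      (M.saddleFun α β x y) := by
  obtain ⟨d, hd, -⟩ := exists_readOff (M.mem_X_iff.1 h.1).2.1
  have ht := h.tendsto_combAvg hM hα hd
  have hwd : ∀ d' : Stationary S A, M.WellDefined α β d'.toPolicy := by
    intro d' s'
    obtain ⟨x', hx'⟩ := exists_tendsto_pairProb hM d'
    exact ⟨_, MDP.tendsto_combAvg β hα (hx' s')⟩
  refine ⟨⟨⟨d.toPolicy, hwd d, J_eq (ht s)⟩, ?_⟩, ⟨⟨d.toPolicy, Jsup_eq (ht s)⟩, ?_⟩,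
    ⟨⟨d.toPolicy, Jinf_eq (ht s)⟩, ?_⟩, ⟨⟨d, J_eq (ht s)⟩, ?_⟩⟩
  · rintro _ ⟨u, hu, rfl⟩
    have hu' : M.WellDefined α β u := hu
    exact (hu'.J_eq_Jsup (s := s)).trans_le (h.Jsup_le hα u s)
  · rintro _ ⟨u, rfl⟩
    exact h.Jsup_le hα u s
  · rintro _ ⟨u, rfl⟩
    exact (M.Jinf_le_Jsup u s β hα).trans (h.Jsup_le hα u s)
  · rintro _ ⟨d', rfl⟩
    exact ((hwd d').J_eq_Jsup (s := s)).trans_le (h.Jsup_le hα _ s)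

theorem exists_limits (hM : M.UnichainAperiodic) (hα : α ∈ Set.Ioo (0 : ℝ) 1) (β : ℝ)
    (d : Stationary S A) : ∃ c e : ℝ, ∀ s : S,
      Tendsto (M.cvarAvg α d.toPolicy s) atTop (𝓝 c) ∧
      Tendsto (M.meanAvg d.toPolicy s) atTop (𝓝 e) ∧
      Tendsto (M.combAvg α β d.toPolicy s) atTop (𝓝 (c + β * e)) := by
  obtain ⟨x, hx⟩ := exists_tendsto_pairProb hM d
  refine ⟨M.value α 0 x, ∑ k, x k * M.r k.1 k.2, fun s => ⟨tendsto_cvarAvg hα (hx s),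
    tendsto_meanAvg (hx s), ?_⟩⟩
  rw [← M.value_eq_add β (M.mem_X_iff.1 (mem_X_of_tendsto (hx s))).2.2]
  exact MDP.tendsto_combAvg β hα (hx s)

theorem exists_optimal_numRandomizations_le_one (hM : M.UnichainAperiodic)
    (hα : α ∈ Set.Ioo (0 : ℝ) 1) (β : ℝ) : ∃ d : Stationary S A,
      M.IsOptimal α β d.toPolicy ∧ M.IsSupOptimal α β d.toPolicy ∧
      M.IsInfOptimal α β d.toPolicy ∧ d.numRandomizations ≤ 1 := by
  obtain ⟨x, y, h, hcard⟩ := M.exists_isSaddle_card_le (β := β) hα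
  have hx := (M.mem_X_iff.1 h.1).2.1
  obtain ⟨d, hd, hpure⟩ := exists_readOff hx
  obtain ⟨h1, h2, h3⟩ := h.optimal hM hα hd
  have h4 := numRandomizations_add hx hd hpure
  exact ⟨d, h1, h2, h3, by omega⟩

end Synthesis

end MDP

/-! ### A criterion for unichain aperiodic chains. -/

section AccessibleState

variable {S : Type*} [Fintype S] [DecidableEq S] {Q : Matrix S S ℝ}

/-- Recurrent classes sharing a state therefore coincide. -/
theorem IsRecurrentClass.eq_reach (hQ : Q ∈ Matrix.rowStochastic ℝ S) {C : Set S}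
    (hC : IsRecurrentClass Q C) {i : S} (hi : i ∈ C) :
    C = reach Q i := by
  refine Set.Subset.antisymm (fun j hj => hC.2.2 i hi j hj) ?_
  rintro j ⟨n, hn⟩
  induction n generalizing j with
  | zero =>
    rw [pow_zero, Matrix.one_apply] at hn
    split_ifs at hn with h
    · exact h ▸ hi
    · exact absurd hn (lt_irrefl _)
  | succ n ih =>
    rw [pow_succ, Matrix.mul_apply] at hn
    by_contra hj
    refine hn.ne' (Finset.sum_eq_zero fun k _ => ?_)
    by_cases hk : k ∈ C
    · rw [hC.2.1 k hk j hj, mul_zero]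
    · rw [le_antisymm (not_lt.1 fun h => hk (ih h)) ((pow_mem hQ n).1 i k), zero_mul]

/-- A chain in which some state can be reached from every state in one step is unichain and
aperiodic. -/
theorem isUnichain_of_forall_pos (hQ : Q ∈ Matrix.rowStochastic ℝ S) {j₀ : S}
    (h : ∀ i, 0 < Q i j₀) : IsUnichain Q := by
  have hmem : ∀ C, IsRecurrentClass Q C → j₀ ∈ C := by
    intro C hC
    obtain ⟨i, hi⟩ := hC.1
    by_contra hj
    exact (h i).ne' (hC.2.1 i hi j₀ hj)
  obtain ⟨k, -, hk⟩ := exists_recurrentClass_reach hQ j₀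
  refine ⟨_, hk, fun C hC => ?_⟩
  rw [hC.eq_reach hQ (hmem C hC), hk.eq_reach hQ (hmem _ hk)]

theorem isAperiodic_of_forall_pos (hQ : Q ∈ Matrix.rowStochastic ℝ S) {j₀ : S}
    (h : ∀ i, 0 < Q i j₀) : IsAperiodic Q := by
  intro C hC i hi p hp
  have hj : j₀ ∈ C := by
    by_contra hj
    exact (h i).ne' (hC.2.1 i hi j₀ hj)
  obtain ⟨n, hn⟩ := hC.2.2 j₀ hj i hi
  have h1 : ∀ k, 0 < (Q ^ 1) k j₀ := fun k => by rw [pow_one]; exact h k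
  -- Waiting one step at `j₀` produces two consecutive return times of `i`.
  have h2 := hp (1 + n) (by omega) (pow_add_pos hQ (h1 i) hn)
  have h3 := hp (1 + (1 + n)) (by omega) (pow_add_pos hQ (h1 i) (pow_add_pos hQ (h1 j₀) hn))
  exact Nat.dvd_one.1 ((Nat.dvd_add_left h2).1 h3)

end AccessibleState

namespace MDP

theorem not_optimal_of_value_lt {S : Type*} {A : S → Type*} [Fintype S] [DecidableEq S]
    [Nonempty S] [∀ i, Fintype (A i)] [∀ i, Nonempty (A i)] {M : MDP S A} {α β : ℝ}
    (hM : M.UnichainAperiodic) (hα : α ∈ Set.Ioo (0 : ℝ) 1) {x x' : Pairs S A → ℝ}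
    (hx : x ∈ M.X) (hx' : x' ∈ M.X) {d : Stationary S A} (hd : ReadOff x d)
    (hlt : M.value α β x < M.value α β x') :
    ¬ M.IsOptimal α β d.toPolicy ∧ ¬ M.IsSupOptimal α β d.toPolicy ∧
      ¬ M.IsInfOptimal α β d.toPolicy := by
  obtain ⟨d', hd', -⟩ := exists_readOff (M.mem_X_iff.1 hx').2.1
  have h := fun s => tendsto_combAvg β hα (tendsto_pairProb_of_readOff hM hx hd s)
  have h' := fun s => tendsto_combAvg β hα (tendsto_pairProb_of_readOff hM hx' hd' s)
  let s := Classical.arbitrary S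
  refine ⟨fun hopt => ?_, fun hopt => ?_, fun hopt => ?_⟩
  · have := hopt.2 d'.toPolicy (fun s => ⟨_, h' s⟩) s
    rw [J_eq (h s), J_eq (h' s)] at this
    exact hlt.not_ge this
  · have := hopt d'.toPolicy s
    rw [Jsup_eq (h s), Jsup_eq (h' s)] at this
    exact hlt.not_ge this
  · have := hopt d'.toPolicy s
    rw [Jinf_eq (h s), Jinf_eq (h' s)] at this
    exact hlt.not_ge this

end MDP

/-! ### The lottery example. -/

section Lottery

/-- The law on `Fin 2` that charges `1` with probability `p`. -/
noncomputable def coin (p : ℝ) (hp : p ∈ Set.Ioo (0 : ℝ) 1) : PMF (Fin 2) :=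
  PMF.ofFintype (fun i => ENNReal.ofReal (if i = 1 then p else 1 - p)) (by
    rw [← ENNReal.ofReal_sum_of_nonneg]
    · simp
    · intro i _
      split_ifs <;> linarith [hp.1, hp.2])

theorem toReal_coin {p : ℝ} (hp : p ∈ Set.Ioo (0 : ℝ) 1) (i : Fin 2) :
    (coin p hp i).toReal = if i = 1 then p else 1 - p := by
  rw [coin, PMF.ofFintype_apply, ENNReal.toReal_ofReal]
  split_ifs <;> linarith [hp.1, hp.2]

/-- In state `0` one either collects the safe reward `1` and stays, or plays a lottery that leads to
the state `1` with probability `p`; in state `1` one collects the reward `H` and plays again. -/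
noncomputable def lottery (p : ℝ) (hp : p ∈ Set.Ioo (0 : ℝ) 1) (H : ℝ) :
    MDP (Fin 2) (fun _ => Fin 2) where
  P i a := if i = 0 ∧ a = 0 then PMF.pure 0 else coin p hp
  r i a := if i = 1 then H else if a = 0 then 1 else 0

variable {p : ℝ} {hp : p ∈ Set.Ioo (0 : ℝ) 1} {H : ℝ}

theorem toReal_lottery_P (i a j : Fin 2) : ((lottery p hp H).P i a j).toReal =
    if i = 0 ∧ a = 0 then (if j = 0 then 1 else 0) else if j = 1 then p else 1 - p := by
  simp only [lottery]
  split_ifs with h1 h2 h2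
  · simp [h2]
  · simp [h2]
  · rw [toReal_coin, if_pos h2]
  · rw [toReal_coin, if_neg h2]

theorem lottery_unichainAperiodic : (lottery p hp H).UnichainAperiodic := by
  intro d
  have hQ := (lottery p hp H).transition_mem_rowStochastic d
  have hpos : ∀ i, 0 < (lottery p hp H).transition d i 0 := by
    intro i
    have h1 : ∀ a, 1 - p ≤ ((lottery p hp H).P i a 0).toReal := by
      intro a
      rw [toReal_lottery_P]
      split_ifs <;> simp_all [hp.1.le]
    have h2 : ∑ a, (d i a).toReal * (1 - p) ≤ (lottery p hp H).transition d i 0 := by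
      rw [MDP.transition, toReal_bind_apply]
      exact Finset.sum_le_sum fun a _ => mul_le_mul_of_nonneg_left (h1 a) ENNReal.toReal_nonneg
    rw [← Finset.sum_mul, sum_toReal, one_mul] at h2
    linarith [hp.2]
  exact ⟨isUnichain_of_forall_pos hQ hpos, isAperiodic_of_forall_pos hQ hpos⟩

/-- The steady-state distribution when the lottery has weight `l`, the action `c` being taken in
state `1`. -/
def lotteryState (p l : ℝ) (c : Fin 2) : Pairs (Fin 2) (fun _ => Fin 2) → ℝ := fun k =>
  if k.1 = 0 then (if k.2 = 0 then 1 - l else l * (1 - p)) else if k.2 = c then l * p else 0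

theorem sum_lotteryState (l : ℝ) (c : Fin 2) (v : Fin 2 → Fin 2 → ℝ) (hv : v 1 0 = v 1 1) :
    ∑ k, lotteryState p l c k * v k.1 k.2 =
      (1 - l) * v 0 0 + l * (1 - p) * v 0 1 + l * p * v 1 0 := by
  rw [Fintype.sum_sigma]
  simp only [Fin.sum_univ_two, lotteryState]
  fin_cases c <;> simp [hv]

theorem lotteryState_mem_X {l : ℝ} (hl : l ∈ Set.Icc (0 : ℝ) 1) (c : Fin 2) :
    lotteryState p l c ∈ (lottery p hp H).X := by
  have h1 := hp.1
  have h2 := hp.2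
  refine ⟨fun j => ?_, ?_, fun k => ?_⟩
  · have := sum_lotteryState (p := p) l c (fun i a => ((lottery p hp H).P i a j).toReal)
      (by simp [toReal_lottery_P])
    simp only [mul_comm] at this ⊢
    rw [this]
    fin_cases j <;> fin_cases c <;>
      simp [lotteryState, Fin.sum_univ_two, toReal_lottery_P] <;> ring
  · have := sum_lotteryState (p := p) l c (fun _ _ => 1) rfl
    simp only [mul_one] at this
    rw [this]
    ring
  · simp only [lotteryState]
    split_ifs
    · linarith [hl.2]
    · exact mul_nonneg hl.1 (by linarith)
    · exact mul_nonneg hl.1 h1.le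
    · exact le_rfl

theorem readOff_lotteryState (hp : p ∈ Set.Ioo (0 : ℝ) 1) (f : Fin 2 → Fin 2) :
    ReadOff (lotteryState p (if f 0 = 0 then 0 else 1) (f 1))
      (deterministic (A := fun _ : Fin 2 => Fin 2) f) := by
  intro i hi a
  have h1 := hp.1
  have h2 : 1 - p ≠ 0 := by linarith [hp.2]
  obtain ⟨c, hc⟩ : ∃ c, f 1 = c := ⟨_, rfl⟩
  obtain ⟨b, hb⟩ : ∃ b, f 0 = b := ⟨_, rfl⟩
  rw [hb, hc] at hi ⊢
  fin_cases b <;> fin_cases c <;> fin_cases i <;> fin_cases a <;>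
    simp_all [deterministic, lotteryState, Fin.sum_univ_two, PMF.pure_apply, h1.ne']

theorem saddleFun_lotteryState (α β l y : ℝ) (c : Fin 2) :
    (lottery p hp H).saddleFun α β (lotteryState p l c) y =
      y + (1 / (1 - α)) * ((1 - l) * max (1 - y) 0 + l * (1 - p) * max (0 - y) 0 +
        l * p * max (H - y) 0) + β * (1 - l + l * p * H) := by
  rw [MDP.saddleFun, sum_lotteryState l c (fun i a => y + (1 / (1 - α)) *
    max ((lottery p hp H).r i a - y) 0 + β * (lottery p hp H).r i a) rfl]
  simp only [lottery, if_pos, zero_ne_one, one_ne_zero, if_false]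
  ring

end Lottery

/-- For all parameters there is a decision process for which no deterministic stationary policy is
optimal. -/
theorem exists_no_deterministic_optimal {α β : ℝ} (hα : α ∈ Set.Ioo (0 : ℝ) 1) (hβ : 0 ≤ β) :
    ∃ M : MDP (Fin 2) (fun _ => Fin 2), M.UnichainAperiodic ∧ ∀ f : Fin 2 → Fin 2,
      ¬ M.IsOptimal α β (deterministic (A := fun _ : Fin 2 => Fin 2) f).toPolicy ∧
      ¬ M.IsSupOptimal α β (deterministic (A := fun _ : Fin 2 => Fin 2) f).toPolicy ∧
      ¬ M.IsInfOptimal α β (deterministic (A := fun _ : Fin 2 => Fin 2) f).toPolicy := by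
  obtain ⟨h0, h1⟩ := hα
  have hp : (1 - α) / 2 ∈ Set.Ioo (0 : ℝ) 1 := ⟨by linarith, by linarith⟩
  -- The choice `p * H = 1 - δ` makes the lottery slightly worse in mean than the safe reward 1. The
  -- weight `l` solves `l * (1 - p) = α`, so the reward `0` has mass `α` and the positive rewards
  -- exactly `1 - α`.
  set p := (1 - α) / 2 with hpdef
  obtain ⟨δ, hδ0, hδ⟩ : ∃ δ : ℝ, 0 < δ ∧ δ * (1 + β) = 1 / 4 :=
    ⟨1 / (4 * (1 + β)), by positivity, by field_simp⟩
  have hδ1 : δ < 1 := by nlinarith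
  obtain ⟨H, hH⟩ : ∃ H, p * H = 1 - δ := ⟨(1 - δ) / p, mul_div_cancel₀ _ hp.1.ne'⟩
  have hH0 : 0 < H := by
    by_contra hcon
    have := mul_nonpos_of_nonneg_of_nonpos hp.1.le (not_lt.1 hcon)
    linarith
  obtain ⟨l, hl⟩ : ∃ l : ℝ, l * (1 + α) = 2 * α := ⟨2 * α / (1 + α), by field_simp⟩
  have hl0 : 0 < l := by nlinarith
  have hl1 : l < 1 := by nlinarith
  set c := 1 / (1 - α) with hc
  have hc1 : c * (1 - α) = 1 := one_div_mul_cancel (by linarith)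
  have hc0 : 0 < c := one_div_pos.2 (by linarith)
  have hM : (lottery p hp H).UnichainAperiodic := lottery_unichainAperiodic
  refine ⟨lottery p hp H, hM, fun f => ?_⟩
  have hmem : (if f 0 = 0 then (0 : ℝ) else 1) ∈ Set.Icc (0 : ℝ) 1 := by
    split_ifs <;> simp
  refine MDP.not_optimal_of_value_lt hM ⟨h0, h1⟩ (lotteryState_mem_X hmem (f 1))
    (lotteryState_mem_X ⟨hl0.le, hl1.le⟩ 0) (readOff_lotteryState hp f) ?_
  -- Dropping the positive parts on the rewards `1` and `H`, whose total mass is `1 - α`, makes `y`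
  -- cancel, so the bound holds for every `y`.
  have hlow : (c + β) * (1 - l * δ) ≤ (lottery p hp H).value α β (lotteryState p l 0) := by
    obtain ⟨y, -, hy⟩ := ((lottery p hp H).isLeast_value α β (lotteryState p l 0)).1
    rw [← hy, saddleFun_lotteryState, ← hc]
    have e1 : (1 - l) * (1 - y) ≤ (1 - l) * max (1 - y) 0 :=
      mul_le_mul_of_nonneg_left (le_max_left _ _) (by linarith)
    have e2 : 0 ≤ l * (1 - p) * max (0 - y) 0 :=
      mul_nonneg (mul_nonneg hl0.le (by linarith [hp.2])) (le_max_right _ _)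
    have e3 : l * p * (H - y) ≤ l * p * max (H - y) 0 :=
      mul_le_mul_of_nonneg_left (le_max_left _ _) (mul_nonneg hl0.le hp.1.le)
    have e4 := mul_le_mul_of_nonneg_left (add_le_add (add_le_add e1 e2) e3) hc0.le
    have e5 : (1 - l) * (1 - y) + 0 + l * p * (H - y) = 1 - l * δ - (1 - α) * y := by
      rw [mul_sub (l * p), mul_assoc l p H, hH, hpdef]
      linear_combination y / 2 * hl
    have e6 : β * (1 - l + l * p * H) = β * (1 - l * δ) := by
      rw [mul_assoc l p H, hH]; ring
    rw [e5, mul_sub, ← mul_assoc c (1 - α), hc1] at e4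
    rw [e6]
    linarith
  refine lt_of_lt_of_le ?_ hlow
  split_ifs
  -- The pure choices are bounded above by testing one `y`: the safe action at `y = 1` gives `1 +
  -- β`, the lottery at `y = 0` gives `(c + β) * (1 - δ)`.
  · have := (lottery p hp H).value_le α β (lotteryState p 0 (f 1))
      ((lottery p hp H).r_mem_Y ⟨0, 0⟩)
    have hr : (lottery p hp H).r 0 0 = 1 := by simp [lottery]
    rw [hr, saddleFun_lotteryState] at this
    refine this.trans_lt ?_
    -- This is the required strict inequality multiplied by `1 - α`; it follows from `l < 2 * α` and
    -- `δ * (1 + β) = 1 / 4`.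
    have e1 : l * (δ * (1 + β * (1 - α))) < α := by
      have k1 : δ * (1 + β * (1 - α)) ≤ 1 / 4 := by
        have := mul_nonneg (mul_nonneg hδ0.le hβ) h0.le
        linarith
      have k2 := mul_le_mul_of_nonneg_left k1 hl0.le
      have k3 := mul_pos hl0 h0
      linarith
    have e2 := mul_pos hc0 (sub_pos.2 e1)
    have e3 : c * (α - l * (δ * (1 + β * (1 - α)))) = (c + β) * (1 - l * δ) - (1 + β) := by
      linear_combination (-(1 + l * δ * β)) * hc1
    have e4 : 1 + (1 / (1 - α)) * ((1 - 0) * max ((1 : ℝ) - 1) 0 + 0 * (1 - p) * max (0 - 1) 0 +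
        0 * p * max (H - 1) 0) + β * (1 - 0 + 0 * p * H) = 1 + β := by simp
    linarith
  · have := (lottery p hp H).value_le α β (lotteryState p 1 (f 1))
      ((lottery p hp H).r_mem_Y ⟨0, 1⟩)
    have hr : (lottery p hp H).r 0 1 = 0 := by simp [lottery]
    rw [hr, saddleFun_lotteryState] at this
    refine this.trans_lt ?_
    rw [← hc, max_eq_left (by linarith : 0 ≤ H - 0)]
    have e1 : 0 + c * ((1 - 1) * max (1 - 0) 0 + 1 * (1 - p) * max (0 - 0) 0 +
        1 * p * (H - 0)) + β * (1 - 1 + 1 * p * H) = (c + β) * (1 - δ) := by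
      rw [← hH]; simp; ring
    rw [e1]
    have e2 : l * δ < 1 * δ := mul_lt_mul_of_pos_right hl1 hδ0
    exact mul_lt_mul_of_pos_left (by linarith) (by linarith)

end MeanCVaR

theorem mainTheorem6 (α β : ℝ) (hα : α ∈ Set.Ioo (0 : ℝ) 1) (hβ : 0 ≤ β) :
    (∀ (S : Type*) (A : S → Type*) [Fintype S] [DecidableEq S] [Nonempty S]
        [∀ i, Fintype (A i)] [∀ i, Nonempty (A i)] (M : MeanCVaR.MDP S A),
      M.UnichainAperiodic →
      ∃ V : ℝ,
        -- the optimal values of the three problems, and the optimum over stationary policies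
        (∀ s : S,
          IsGreatest ((fun u => M.J α β u s) '' {u | M.WellDefined α β u}) V ∧
          IsGreatest (Set.range fun u : MeanCVaR.Policy S A => M.Jsup α β u s) V ∧
          IsGreatest (Set.range fun u : MeanCVaR.Policy S A => M.Jinf α β u s) V ∧
          IsGreatest (Set.range fun d : MeanCVaR.Stationary S A => M.J α β d.toPolicy s) V) ∧
        -- the criterion is well defined for stationary policies
        (∀ d : MeanCVaR.Stationary S A, ∃ c e : ℝ, ∀ s : S,
          Tendsto (M.cvarAvg α d.toPolicy s) atTop (𝓝 c) ∧
          Tendsto (M.meanAvg d.toPolicy s) atTop (𝓝 e) ∧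
          Tendsto (M.combAvg α β d.toPolicy s) atTop (𝓝 (c + β * e))) ∧
        -- an optimal stationary policy with at most one randomization
        (∃ d : MeanCVaR.Stationary S A,
          M.IsOptimal α β d.toPolicy ∧ M.IsSupOptimal α β d.toPolicy ∧
          M.IsInfOptimal α β d.toPolicy ∧ d.numRandomizations ≤ 1) ∧
        -- the saddle value and saddle points
        M.IsMaxMin α β V ∧ M.IsMinMax α β V ∧
        (∃ x y, M.IsSaddle α β x y) ∧
        (∀ x y, M.IsSaddle α β x y → M.saddleFun α β x y = V) ∧
        -- the two linear programs
        (Set.extremePoints ℝ M.X).Finite ∧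
        (∃ y z w, M.PrimalOptimal α β y z w) ∧
        (∃ x z, M.DualOptimal α β x z) ∧
        (∀ y z₁ w x z₂, M.PrimalOptimal α β y z₁ w → M.DualOptimal α β x z₂ →
          M.IsSaddle α β x y ∧ z₁ = V ∧ z₂ = V ∧
          (∃ d : MeanCVaR.Stationary S A, MeanCVaR.ReadOff x d) ∧
          ∀ d : MeanCVaR.Stationary S A, MeanCVaR.ReadOff x d →
            M.IsOptimal α β d.toPolicy ∧ M.IsSupOptimal α β d.toPolicy ∧
            M.IsInfOptimal α β d.toPolicy)) ∧
    -- stationary deterministic policies need not suffice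
    (∃ (n : ℕ) (m : Fin (n + 1) → ℕ)
        (M : MeanCVaR.MDP (Fin (n + 1)) (fun i => Fin (m i + 1))),
      M.UnichainAperiodic ∧
      ∀ f : (i : Fin (n + 1)) → Fin (m i + 1),
        ¬ M.IsOptimal α β (MeanCVaR.deterministic f).toPolicy ∧
        ¬ M.IsSupOptimal α β (MeanCVaR.deterministic f).toPolicy ∧
        ¬ M.IsInfOptimal α β (MeanCVaR.deterministic f).toPolicy) := by
  refine ⟨fun S A _ _ _ _ _ M hM => ?_, ?_⟩
  · obtain ⟨x₀, y₀, h⟩ := M.exists_isSaddle (β := β) hα.2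
    refine ⟨M.saddleFun α β x₀ y₀, h.isGreatest_criteria hM hα,
      MeanCVaR.MDP.exists_limits hM hα β,
      MeanCVaR.MDP.exists_optimal_numRandomizations_le_one hM hα β, h.isMaxMin, h.isMinMax,
      ⟨x₀, y₀, h⟩, fun x y h' => h'.eq h, M.finite_extremePoints_X,
      ⟨_, _, _, h.primalOptimal hα.2⟩, ⟨_, _, h.dualOptimal⟩, fun y z₁ w x z₂ h₁ h₂ => ?_⟩
    obtain ⟨hs, hz₁, hz₂⟩ := h.of_optimal hα.2 h₁ h₂
    obtain ⟨d, hd, -⟩ := MeanCVaR.MDP.exists_readOff (M.mem_X_iff.1 hs.1).2.1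
    exact ⟨hs, hz₁, hz₂, ⟨d, hd⟩, fun d hd => hs.optimal hM hα hd⟩
  · obtain ⟨M, hM, h⟩ := MeanCVaR.exists_no_deterministic_optimal hα hβ
    exact ⟨1, fun _ => 1, M, hM, h⟩
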